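/- Let $G=(V,E)$ be a finite connected graph without loops and multiple edges. A PEPS on $G$ consists of physical dimensions $d_v$ ($v\in V$), bond dimensions $D_e\ge 1$ ($e\in E$), and for every vertex $v$ a complex tensor $A_v$ with one physical index in $\{1,\dots,d_v\}$ and one virtual index in $\{1,\dots,D_e\}$ for every edge $e$ incident to $v$; it generates the state $$|\Psi_A\rangle=\sum_{s}\Big(\sum_{\eta\in\prod_e\{1,\dots,D_e\}}\ \prod_{v\in V}A_v\big((\eta_e)_{e\ni v},s_v\big)\Big)\,|s\rangle .$$ For a region $R\subseteq V$, let $A_R$ be the blocked tensor, obtained by contracting the tensors $A_v$, $v\in R$, along all edges with both endpoints in $R$; its virtual indices belong to the edges with exactly one endpoint in $R$. The region $R$ is injective if $A_R$ is injective as a linear map from the virtual to the physical space. Let $A$ and $B$ be two PEPS on $G$ with the same physical dimensions and with bond dimensions $(D_e)$ and $(D'_e)$, and suppose that they generate the same state, $|\Psi_A\rangle=|\Psi_B\rangle$. Suppose that 1. for every edge $e$ both PEPS can be blocked into a three-partite injective MPS around $e$, that is, there is a partition $V=R_1\sqcup R_2\sqcup R_3$ ($R_3$ may be empty) such that $e$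 is the one and only edge between $R_1$ and $R_2$, and such that $R_1,R_2,R_3$ are injective regions for $A$ and for $B$; 2. for every site $v$ there are regions $R$ and $S$ that differ only in the site $v$ and such that $R$, $S$, $V\setminus R$ and $V\setminus S$ are injective regions for $A$ and for $B$. Then $D_e=D'_e$ for every edge $e$, and the tensors are related by a local gauge: for any fixed orientation of the edges there are invertible $D_e\times D_e$ matrices $Z_e$ such that, for every vertex $v$, the tensor $B_v$ is obtained from $A_v$ by contracting the virtual index of every edge $e$ that leaves $v$ with $Z_e$ and the virtual index of every edge $e$ that enters $v$ with $Z_e^{-1}$: $$B_v(\beta,s)=\sum_{\alpha}A_v(\alpha,s)\prod_{e\text{ leaves }v}(Z_e)_{\alpha_e\beta_e}\prod_{e\text{ enters }v}(Z_e^{-1})_{\beta_e\alpha_e}.$$ Moreover, the gauge is unique up to constants: if $(Z_e)$ and $(Z'_e)$ both relate $A$ to $B$ in this way, then for every edge $e$ there is a constant $c_e\neq 0$ with $Z'_e=c_eZ_e$. -/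

import Mathlib

/-- A projected entangled-pair state on the graph `G`, with physical dimension `d v` at the
vertex `v` and bond dimension `D e` at the edge `e`. The tensor at `v` has one virtual index for
every edge incident to `v` and one physical index. -/
structure PEPS {V : Type*} (G : SimpleGraph V) (d : V → ℕ) (D : G.edgeSet → ℕ) where
  tensor : ∀ v : V,
    (∀ e : {e : G.edgeSet // v ∈ (e : Sym2 V)}, Fin (D e.1)) → Fin (d v) → ℂ

/-- The edges with at least one endpoint in `R`. -/
abbrev TouchingEdge {V : Type*} (G : SimpleGraph V) (R : Finset V) : Type _ :=
  {e : G.edgeSet // ∃ v ∈ R, v ∈ (e : Sym2 V)}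

/-- The edges with one endpoint in `R` and one endpoint outside `R`. -/
abbrev BoundaryEdge {V : Type*} (G : SimpleGraph V) (R : Finset V) : Type _ :=
  {e : G.edgeSet // (∃ v ∈ R, v ∈ (e : Sym2 V)) ∧ ∃ w, w ∉ R ∧ w ∈ (e : Sym2 V)}

namespace PEPS

section

variable {V : Type*} [Fintype V] [DecidableEq V] {G : SimpleGraph V} [DecidableRel G.Adj]
  {d : V → ℕ} {D : G.edgeSet → ℕ}

/-- The state generated by the PEPS, given by its coefficients in the product basis: all virtual
indices are contracted along the edges. -/
def state (A : PEPS G d D) (s : ∀ v, Fin (d v)) : ℂ :=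
  ∑ η : (∀ e : G.edgeSet, Fin (D e)), ∏ v, A.tensor v (fun e => η e.1) (s v)

/-- The tensor obtained by blocking the tensors in the region `R`: the indices on the edges inside
`R` are contracted, the indices on the boundary edges are the virtual indices of the blocked
tensor. -/
def blocked (A : PEPS G d D) (R : Finset V) (β : ∀ e : BoundaryEdge G R, Fin (D e.1))
    (s : ∀ v : R, Fin (d v)) : ℂ :=
  ∑ η : (∀ e : TouchingEdge G R, Fin (D e.1)),
    if ∀ e : BoundaryEdge G R, η ⟨e.1, e.2.1⟩ = β e then
      ∏ v : R, A.tensor v (fun e => η ⟨e.1, v.1, v.2, e.2⟩) (s v)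
    else 0

/-- The region `R` is injective: the blocked tensor is injective as a (linear) map from the virtual
space to the physical space. -/
def InjectiveOn (A : PEPS G d D) (R : Finset V) : Prop :=
  ∀ X : (∀ e : BoundaryEdge G R, Fin (D e.1)) → ℂ,
    (∀ s : ∀ v : R, Fin (d v), ∑ β, X β * A.blocked R β s = 0) → X = 0

/-- `R₁, R₂, R₃` partition the vertices, and `e` is the one and only edge between `R₁` and `R₂`, so
that blocking gives a three-partite MPS in which the bond between the first two sites is `e`. -/
def IsTripartitionAround (e : G.edgeSet) (R₁ R₂ R₃ : Finset V) : Prop :=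
  Disjoint R₁ R₂ ∧ Disjoint R₁ R₃ ∧ Disjoint R₂ R₃ ∧ R₁ ∪ R₂ ∪ R₃ = Finset.univ ∧
    ∀ f : G.edgeSet,
      ((∃ u ∈ R₁, u ∈ (f : Sym2 V)) ∧ (∃ w ∈ R₂, w ∈ (f : Sym2 V))) ↔ f = e

/-- `A` can be blocked into a three-partite injective MPS around the edge `e`, with the given
parts. -/
def IsInjectiveMPSAround (A : PEPS G d D) (e : G.edgeSet) (R₁ R₂ R₃ : Finset V) : Prop :=
  IsTripartitionAround e R₁ R₂ R₃ ∧ A.InjectiveOn R₁ ∧ A.InjectiveOn R₂ ∧ A.InjectiveOn R₃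

/-- The local gauge `Z` transforms `A` into `B`. The edge `e` is oriented away from `tail e`;
the matrix `Z e` is contracted with the index of `e` at the vertex `tail e`, and `(Z e)⁻¹` with the
index of `e` at the other endpoint. -/
def IsGauge (tail : G.edgeSet → V) (A B : PEPS G d D) (Z : ∀ e, GL (Fin (D e)) ℂ) : Prop :=
  ∀ (v : V) (β : ∀ e : {e : G.edgeSet // v ∈ (e : Sym2 V)}, Fin (D e.1)) (s : Fin (d v)),
    B.tensor v β s =
      ∑ α : (∀ e : {e : G.edgeSet // v ∈ (e : Sym2 V)}, Fin (D e.1)),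
        A.tensor v α s * ∏ e : {e : G.edgeSet // v ∈ (e : Sym2 V)},
          if tail e.1 = v then (Z e.1).val (α e) (β e) else ((Z e.1)⁻¹).val (β e) (α e)

end

end PEPS

/-! Why it holds. Cut the state along the boundary of a region `R`. If `A_R` and the complementary
tensor of `B` are injective, a matrix `W` on the cut bonds satisfies `B_R = W A_R` and carries the
complement of `B` to that of `A` (`exists_bond_matrix`).

Around an edge `e`, take the bond matrices `W₁`, `W₂`, `W` of `R₁`, `R₂` and `R₁ ∪ R₂`. Since `e` is
the only bond between `R₁` and `R₂`, contracting `W₁` with `W₂` along `e` on the `B` side must give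
`W` times the identity on the bond `e` of `A`. Hence the product of every slice of `W₁` along `e`,
transposed, with every slice of `W₂` is a scalar matrix, and some scalar is nonzero
(`exists_bondSlice_transpose_mul`). A nonzero scalar gives `D_e ≤ D'_e`, and symmetry gives
equality. The slices are then square, so all slices of `W₁` are multiples of one invertible matrix,
which is the gauge on `e`: inserting any matrix on `e` in `B` amounts to inserting its conjugate in
`A` (`exists_edge_gauge`).

Once `A` is transformed by these gauges, it and `B` agree under every insertion on a single edge.
The bond matrix of a region then commutes with all one-bond matrices, so it is a scalar, and the
blocked tensors are proportional (`exists_proportional_of_insertions`). Comparing two regions that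
differ in one site and cancelling the common part makes the site tensors proportional
(`vertex_proportional`). The state is nonzero, so the site scalars multiply to one; on a connected
graph they are therefore a boundary of edge scalars, which are absorbed into the gauge
(`EdgeEnds.exists_boundaryHom_eq`).

For uniqueness, injectivity of a region with `e` on its boundary forces two gauges to have the same
tensor product on that boundary, which determines each factor up to a constant (`gauge_unique`).

Tensors are encoded as functions of the indices of all edges, with `DependsOn` recording the
relevant ones. Blocked tensors of different regions then share one type. -/

open Matrix

set_option linter.unusedSectionVars false

/-! ### Contraction as a partial sum over index configurations -/

section Marginal

variable {ι : Type*} [Fintype ι] [DecidableEq ι] {X : ι → Type*} [∀ i, Fintype (X i)]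

open Classical in
/-- The sum of `f` over all configurations that agree with `x` outside `K`. -/
noncomputable def marginalSum (K : Finset ι) (f : (∀ i, X i) → ℂ) (x : ∀ i, X i) : ℂ :=
  ∑ y with ∀ i ∉ K, y i = x i, f y

theorem marginalSum_congr {K : Finset ι} {f g : (∀ i, X i) → ℂ} {x : ∀ i, X i}
    (h : ∀ y, (∀ i ∉ K, y i = x i) → f y = g y) : marginalSum K f x = marginalSum K g x := by
  classical
  exact Finset.sum_congr rfl fun y hy => h y (by simpa using hy)

theorem marginalSum_base {K : Finset ι} (f : (∀ i, X i) → ℂ) {x y : ∀ i, X i}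
    (h : ∀ i ∉ K, y i = x i) : marginalSum K f y = marginalSum K f x := by
  classical
  refine Finset.sum_congr ?_ fun _ _ => rfl
  ext z
  simp only [Finset.mem_filter, Finset.mem_univ, true_and]
  exact forall₂_congr fun i hi => by rw [h i hi]

@[simp]
theorem marginalSum_empty (f : (∀ i, X i) → ℂ) (x : ∀ i, X i) : marginalSum ∅ f x = f x := by
  classical
  have : (Finset.univ.filter fun y : ∀ i, X i => ∀ i ∉ (∅ : Finset ι), y i = x i) = {x} := by
    ext y
    simp [funext_iff]
  rw [marginalSum, Finset.filter_congr_decidable, this, Finset.sum_singleton]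

theorem marginalSum_univ (f : (∀ i, X i) → ℂ) (x : ∀ i, X i) :
    marginalSum Finset.univ f x = ∑ y, f y := by
  classical
  simp [marginalSum]

theorem marginalSum_singleton (e : ι) (f : (∀ i, X i) → ℂ) (x : ∀ i, X i) :
    marginalSum {e} f x = ∑ k, f (Function.update x e k) := by
  classical
  refine Finset.sum_bij' (fun y _ => y e) (fun k _ => Function.update x e k) ?_ ?_ ?_ ?_ ?_
  · simp
  · intro k _
    simp only [Finset.mem_singleton, Finset.mem_filter, Finset.mem_univ, true_and]
    intro i hi
    simp [hi]
  · intro y hy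
    simp only [Finset.mem_singleton, Finset.mem_filter, Finset.mem_univ, true_and] at hy
    ext i
    by_cases hi : i = e
    · subst hi; simp
    · simp [hi, hy i hi]
  · simp
  · intro y hy
    simp only [Finset.mem_singleton, Finset.mem_filter, Finset.mem_univ, true_and] at hy
    congr 1
    ext i
    by_cases hi : i = e
    · subst hi; simp
    · simp [hi, hy i hi]

theorem marginalSum_union {K L : Finset ι} (h : Disjoint K L) (f : (∀ i, X i) → ℂ)
    (x : ∀ i, X i) : marginalSum (K ∪ L) f x = marginalSum K (marginalSum L f) x := by
  classical
  unfold marginalSum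
  -- The final configuration `z` determines the intermediate one: it equals `z` on `K` and `x`
  -- elsewhere.
  rw [Finset.sum_comm' (t' := Finset.univ.filter fun z : ∀ i, X i => ∀ i ∉ K ∪ L, z i = x i)
    (s' := fun z => {K.piecewise z x})]
  · simp
  · intro y z
    simp only [Finset.mem_filter, Finset.mem_univ, true_and, Finset.mem_singleton,
      Finset.mem_union, not_or]
    constructor
    · rintro ⟨hy, hz⟩
      refine ⟨?_, fun i hi => by rw [hz i hi.2, hy i hi.1]⟩
      ext i
      by_cases hi : i ∈ K
      · simp [hi, hz i (Finset.disjoint_left.1 h hi)]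
      · simp [hi, hy i hi]
    · rintro ⟨rfl, hz⟩
      refine ⟨fun i hi => by simp [hi], fun i hi => ?_⟩
      by_cases hK : i ∈ K
      · simp [hK]
      · simp [hK, hz i ⟨hK, hi⟩]

/-- The marginal sum as a sum over configurations on a subtype. -/
theorem marginalSum_eq_sum_subtype (K : Finset ι) (P : ι → Prop) [DecidablePred P]
    [Fintype (∀ i : {i // P i}, X i)]
    (hP : ∀ i, P i ↔ i ∈ K) (f : (∀ i, X i) → ℂ) (x : ∀ i, X i) :
    marginalSum K f x =
      ∑ p : (∀ i : {i // P i}, X i), f (fun i => if h : P i then p ⟨i, h⟩ else x i) := by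
  classical
  refine Finset.sum_bij' (fun y _ => fun i => y i)
    (fun p _ => fun i => if h : P i then p ⟨i, h⟩ else x i) ?_ ?_ ?_ ?_ ?_
  · simp
  · intro p _
    simp only [Finset.mem_filter, Finset.mem_univ, true_and]
    intro i hi
    rw [dif_neg (by rwa [hP])]
  · intro y hy
    simp only [Finset.mem_filter, Finset.mem_univ, true_and] at hy
    ext i
    by_cases hi : P i
    · simp [hi]
    · simp [hi, hy i (by rwa [← hP])]
  · intro p _
    ext i
    simp [i.2]
  · intro y hy
    simp only [Finset.mem_filter, Finset.mem_univ, true_and] at hy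
    congr 1
    ext i
    by_cases hi : P i
    · simp [hi]
    · simp [hi, hy i (by rwa [← hP])]

theorem marginalSum_dependsOn {K : Finset ι} {S : Set ι} {f : (∀ i, X i) → ℂ}
    (hf : DependsOn f (S ∪ K)) : DependsOn (marginalSum K f) S := by
  intro x y hxy
  rw [marginalSum_eq_sum_subtype K (· ∈ K) (fun _ => Iff.rfl),
    marginalSum_eq_sum_subtype K (· ∈ K) (fun _ => Iff.rfl)]
  refine Finset.sum_congr rfl fun p _ => hf fun i hi => ?_
  by_cases h : i ∈ K
  · simp [h]
  · simpa [h] using hxy i (by simpa [h] using hi)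

theorem marginalSum_mul_left {K : Finset ι} {S : Set ι} {f : (∀ i, X i) → ℂ}
    (hf : DependsOn f S) (h : Disjoint S K) (g : (∀ i, X i) → ℂ) (x : ∀ i, X i) :
    marginalSum K (fun y => f y * g y) x = f x * marginalSum K g x := by
  classical
  unfold marginalSum
  rw [Finset.mul_sum]
  refine Finset.sum_congr rfl fun y hy => ?_
  simp only [Finset.mem_filter, Finset.mem_univ, true_and] at hy
  dsimp only
  rw [hf (x := y) (y := x) fun i hi => hy i fun hK => Set.disjoint_left.1 h hi hK]

theorem marginalSum_mul_right {K : Finset ι} {S : Set ι} {f : (∀ i, X i) → ℂ}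
    (hf : DependsOn f S) (h : Disjoint S K) (g : (∀ i, X i) → ℂ) (x : ∀ i, X i) :
    marginalSum K (fun y => g y * f y) x = marginalSum K g x * f x := by
  rw [mul_comm, ← marginalSum_mul_left hf h]
  simp only [mul_comm]

theorem marginalSum_const_mul (K : Finset ι) (c : ℂ) (f : (∀ i, X i) → ℂ) (x : ∀ i, X i) :
    marginalSum K (fun y => c * f y) x = c * marginalSum K f x := by
  simp only [marginalSum, Finset.mul_sum]

theorem marginalSum_mul_const (K : Finset ι) (c : ℂ) (f : (∀ i, X i) → ℂ) (x : ∀ i, X i) :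
    marginalSum K (fun y => f y * c) x = marginalSum K f x * c := by
  simp only [marginalSum, Finset.sum_mul]

theorem marginalSum_sum {κ : Type*} (s : Finset κ) (K : Finset ι) (f : κ → (∀ i, X i) → ℂ)
    (x : ∀ i, X i) :
    marginalSum K (fun y => ∑ k ∈ s, f k y) x = ∑ k ∈ s, marginalSum K (f k) x := by
  simp only [marginalSum]
  rw [Finset.sum_comm]

theorem marginalSum_sub (K : Finset ι) (f g : (∀ i, X i) → ℂ) (x : ∀ i, X i) :
    marginalSum K (fun y => f y - g y) x = marginalSum K f x - marginalSum K g x := by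
  simp only [marginalSum, Finset.sum_sub_distrib]

theorem marginalSum_comm {Y : ι → Type*} [∀ i, Fintype (Y i)] (K L : Finset ι)
    (f : (∀ i, X i) → (∀ i, Y i) → ℂ) (x : ∀ i, X i) (y : ∀ i, Y i) :
    marginalSum K (fun x' => marginalSum L (f x') y) x =
      marginalSum L (fun y' => marginalSum K (fun x' => f x' y') x) y := by
  simp only [marginalSum]
  rw [Finset.sum_comm]

/-- All base points involved agree off `K`, so both sums range over the same fibre and can be
exchanged. -/
theorem marginalSum_swap (K : Finset ι) (f : (∀ i, X i) → (∀ i, X i) → ℂ) (x : ∀ i, X i) :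
    marginalSum K (fun y => marginalSum K (f y) y) x =
      marginalSum K (fun z => marginalSum K (fun y => f y z) z) x := by
  rw [marginalSum_congr (g := fun y => marginalSum K (f y) x)
      fun y hy => marginalSum_base _ hy, marginalSum_comm]
  exact marginalSum_congr fun z hz => (marginalSum_base _ hz).symm

theorem marginalSum_prod (K : Finset ι) (g : ∀ i, X i → ℂ) (x : ∀ i, X i) :
    marginalSum K (fun y => ∏ i ∈ K, g i (y i)) x = ∏ i ∈ K, ∑ k, g i k := by
  induction K using Finset.induction_on generalizing x with
  | empty => simp
  | insert e K he ih =>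
    rw [Finset.insert_eq, marginalSum_union (by simpa using he), marginalSum_singleton,
      ← Finset.insert_eq, Finset.prod_insert he, Finset.sum_mul]
    refine Finset.sum_congr rfl fun k _ => ?_
    have hd : DependsOn (fun y : ∀ i, X i => g e (y e)) {e} := fun x y h => by
      simp [h e rfl]
    simp only [Finset.prod_insert he]
    rw [marginalSum_mul_left hd (by simpa using he), ih]
    simp

end Marginal

/-! ### Kronecker deltas on a set of indices -/

section Agree

variable {ι : Type*} [Fintype ι] [DecidableEq ι] {X : ι → Type*} [∀ i, Fintype (X i)]

open Classical in
/-- The Kronecker delta of two configurations restricted to `K`. -/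
noncomputable def kroneckerOn (K : Finset ι) (x y : ∀ i, X i) : ℂ :=
  if ∀ i ∈ K, x i = y i then 1 else 0

theorem kroneckerOn_of_eq {K : Finset ι} {x y : ∀ i, X i} (h : ∀ i ∈ K, x i = y i) :
    kroneckerOn K x y = 1 := if_pos h

theorem kroneckerOn_of_ne {K : Finset ι} {x y : ∀ i, X i} {e : ι} (he : e ∈ K)
    (h : x e ≠ y e) : kroneckerOn K x y = 0 := if_neg fun H => h (H e he)

theorem kroneckerOn_comm (K : Finset ι) (x y : ∀ i, X i) :
    kroneckerOn K x y = kroneckerOn K y x := by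
  classical
  exact if_congr (forall₂_congr fun _ _ => eq_comm) rfl rfl

theorem kroneckerOn_dependsOn (K : Finset ι) (x : ∀ i, X i) :
    DependsOn (fun y => kroneckerOn K x y) (K : Set ι) := by
  intro y z h
  unfold kroneckerOn
  have : (∀ i ∈ K, x i = y i) ↔ ∀ i ∈ K, x i = z i := forall₂_congr fun i hi => by rw [h i hi]
  dsimp only
  split_ifs <;> tauto

/-- Summing against a Kronecker delta on a larger set evaluates at the base point. -/
theorem marginalSum_mul_kroneckerOn {K K' : Finset ι} (h : K ⊆ K') (f : (∀ i, X i) → ℂ)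
    (x : ∀ i, X i) : marginalSum K (fun y => f y * kroneckerOn K' x y) x = f x := by
  classical
  rw [marginalSum, Finset.sum_eq_single x]
  · rw [kroneckerOn_of_eq fun _ _ => rfl, mul_one]
  · intro y hy hyx
    simp only [Finset.mem_filter, Finset.mem_univ, true_and] at hy
    obtain ⟨e, he⟩ := Function.ne_iff.1 hyx
    have heK : e ∈ K := by
      by_contra hK
      exact he (hy e hK)
    rw [kroneckerOn_of_ne (h heK) (Ne.symm he), mul_zero]
  · simp

/-- If `f` only depends on `K`, the marginal sum over `K` does not depend on the base point. -/
theorem marginalSum_base_irrel {K : Finset ι} {f : (∀ i, X i) → ℂ} (hf : DependsOn f (K : Set ι))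
    (x y : ∀ i, X i) : marginalSum K f x = marginalSum K f y := by
  have : DependsOn (marginalSum K f) (∅ : Set ι) := marginalSum_dependsOn (by simpa using hf)
  exact this.empty x y

end Agree

/-! ### Matrices acting on the legs of a tensor -/

section Action

variable {ι : Type*} [Fintype ι] [DecidableEq ι] {X : ι → Type*} [∀ i, Fintype (X i)]
  [∀ i, DecidableEq (X i)]

/-- The family of matrices `M` acting on the coordinates in `K` of a tensor `f`. -/
noncomputable def matrixAct (K : Finset ι) (M : ∀ i, Matrix (X i) (X i) ℂ)
    (f : (∀ i, X i) → ℂ) (x : ∀ i, X i) : ℂ :=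
  marginalSum K (fun y => (∏ i ∈ K, M i (x i) (y i)) * f y) x

@[simp]
theorem matrixAct_empty (M : ∀ i, Matrix (X i) (X i) ℂ) (f : (∀ i, X i) → ℂ) :
    matrixAct ∅ M f = f := by
  ext x
  simp [matrixAct]

theorem matrixAct_congr {K : Finset ι} {M N : ∀ i, Matrix (X i) (X i) ℂ}
    (h : ∀ i ∈ K, M i = N i) (f : (∀ i, X i) → ℂ) : matrixAct K M f = matrixAct K N f := by
  ext x
  refine marginalSum_congr fun y _ => ?_
  rw [Finset.prod_congr rfl fun i hi => by rw [h i hi]]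

theorem matrixAct_singleton (e : ι) (M : ∀ i, Matrix (X i) (X i) ℂ) (f : (∀ i, X i) → ℂ)
    (x : ∀ i, X i) :
    matrixAct {e} M f x = ∑ k, M e (x e) k * f (Function.update x e k) := by
  simp [matrixAct, marginalSum_singleton]

theorem matrixAct_dependsOn {K : Finset ι} {S : Set ι} {f : (∀ i, X i) → ℂ} (hK : (K : Set ι) ⊆ S)
    (hf : DependsOn f S) (M : ∀ i, Matrix (X i) (X i) ℂ) : DependsOn (matrixAct K M f) S := by
  intro x y hxy
  have hprod : ∀ z : ∀ i, X i, ∏ i ∈ K, M i (x i) (z i) = ∏ i ∈ K, M i (y i) (z i) :=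
    fun z => Finset.prod_congr rfl fun i hi => by rw [hxy i (hK hi)]
  simp only [matrixAct, hprod]
  refine marginalSum_dependsOn (S := S) (K := K) ?_ hxy
  intro z w hzw
  dsimp only
  rw [hf fun i hi => hzw i (Or.inl hi)]
  congr 1
  exact Finset.prod_congr rfl fun i hi => by rw [hzw i (Or.inr hi)]

theorem matrixAct_mul (K : Finset ι) (M N : ∀ i, Matrix (X i) (X i) ℂ) (f : (∀ i, X i) → ℂ) :
    matrixAct K M (matrixAct K N f) = matrixAct K (fun i => M i * N i) f := by
  ext x
  unfold matrixAct
  simp only [← marginalSum_const_mul]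
  rw [marginalSum_swap]
  refine marginalSum_congr fun z hz => ?_
  simp only [← mul_assoc, ← Finset.prod_mul_distrib]
  rw [marginalSum_mul_const,
    marginalSum_prod K (fun i k => M i (x i) k * N i k (z i))]
  simp only [Matrix.mul_apply]

theorem matrixAct_one (K : Finset ι) (f : (∀ i, X i) → ℂ) :
    matrixAct K (fun _ => 1) f = f := by
  ext x
  have : ∀ y : ∀ i, X i, ∏ i ∈ K, (1 : Matrix (X i) (X i) ℂ) (x i) (y i) = kroneckerOn K x y := by
    intro y
    by_cases h : ∀ i ∈ K, x i = y i
    · rw [kroneckerOn_of_eq h]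
      exact Finset.prod_eq_one fun i hi => by rw [h i hi, Matrix.one_apply_eq]
    · push Not at h
      obtain ⟨i, hi, hne⟩ := h
      rw [kroneckerOn_of_ne hi hne]
      exact Finset.prod_eq_zero hi (Matrix.one_apply_ne hne)
  simp only [matrixAct, this, mul_comm (kroneckerOn K x _)]
  exact marginalSum_mul_kroneckerOn subset_rfl f x

theorem matrixAct_cancel {K : Finset ι} {M N : ∀ i, Matrix (X i) (X i) ℂ}
    (h : ∀ i ∈ K, M i * N i = 1) (f : (∀ i, X i) → ℂ) :
    matrixAct K M (matrixAct K N f) = f := by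
  rw [matrixAct_mul, matrixAct_congr h, matrixAct_one]

theorem matrixAct_union {K L : Finset ι} (h : Disjoint K L) (M : ∀ i, Matrix (X i) (X i) ℂ)
    (f : (∀ i, X i) → ℂ) : matrixAct (K ∪ L) M f = matrixAct K M (matrixAct L M f) := by
  ext x
  unfold matrixAct
  rw [marginalSum_union h]
  refine marginalSum_congr fun y hy => ?_
  rw [← marginalSum_const_mul]
  refine marginalSum_congr fun z hz => ?_
  rw [Finset.prod_union h, mul_assoc]
  congr 1
  · exact Finset.prod_congr rfl fun i hi => by rw [hz i (Finset.disjoint_left.1 h hi)]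
  · congr 1
    exact Finset.prod_congr rfl fun i hi => by rw [hy i (Finset.disjoint_right.1 h hi)]

theorem matrixAct_mul_left {K : Finset ι} {S : Set ι} {f : (∀ i, X i) → ℂ}
    (hf : DependsOn f S) (h : Disjoint S K) (M : ∀ i, Matrix (X i) (X i) ℂ)
    (g : (∀ i, X i) → ℂ) :
    matrixAct K M (fun y => f y * g y) = fun x => f x * matrixAct K M g x := by
  ext x
  unfold matrixAct
  rw [← marginalSum_mul_left hf h]
  exact marginalSum_congr fun y _ => by ring

theorem matrixAct_mul_right {K : Finset ι} {S : Set ι} {f : (∀ i, X i) → ℂ}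
    (hf : DependsOn f S) (h : Disjoint S K) (M : ∀ i, Matrix (X i) (X i) ℂ)
    (g : (∀ i, X i) → ℂ) :
    matrixAct K M (fun y => g y * f y) = fun x => matrixAct K M g x * f x := by
  simp only [mul_comm _ (f _)]
  exact matrixAct_mul_left hf h M g

theorem marginalSum_matrixAct {K L : Finset ι} (h : Disjoint K L)
    (M : ∀ i, Matrix (X i) (X i) ℂ) (f : (∀ i, X i) → ℂ) :
    marginalSum L (matrixAct K M f) = matrixAct K M (marginalSum L f) := by
  ext x
  unfold matrixAct
  have key : marginalSum K (fun y => (∏ i ∈ K, M i (x i) (y i)) * marginalSum L f y) x =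
      marginalSum (K ∪ L) (fun y => (∏ i ∈ K, M i (x i) (y i)) * f y) x := by
    rw [marginalSum_union h]
    refine marginalSum_congr fun y hy => ?_
    rw [← marginalSum_const_mul]
    refine marginalSum_congr fun z hz => ?_
    rw [Finset.prod_congr rfl fun i hi => by rw [← hz i (Finset.disjoint_left.1 h hi)]]
  rw [key, Finset.union_comm, marginalSum_union h.symm]
  refine marginalSum_congr fun y hy => marginalSum_congr fun z hz => ?_
  rw [Finset.prod_congr rfl fun i hi => by rw [hy i (Finset.disjoint_left.1 h hi)]]

/-- Contraction is a bilinear pairing, so a matrix moves from one factor to the other as its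
transpose. -/
theorem marginalSum_mul_matrixAct {K L : Finset ι} (h : L ⊆ K) (M : ∀ i, Matrix (X i) (X i) ℂ)
    (f g : (∀ i, X i) → ℂ) (x : ∀ i, X i) :
    marginalSum K (fun y => f y * matrixAct L M g y) x =
      marginalSum K (fun y => matrixAct L (fun i => (M i)ᵀ) f y * g y) x := by
  have hL : ∀ x, marginalSum L (fun y => f y * matrixAct L M g y) x =
      marginalSum L (fun y => matrixAct L (fun i => (M i)ᵀ) f y * g y) x := by
    intro x
    simp only [matrixAct, ← marginalSum_const_mul, ← marginalSum_mul_const]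
    rw [marginalSum_swap]
    refine marginalSum_congr fun z _ => marginalSum_congr fun y _ => ?_
    simp only [Matrix.transpose_apply]
    ring
  rw [← Finset.sdiff_union_of_subset h, marginalSum_union Finset.sdiff_disjoint,
    marginalSum_union Finset.sdiff_disjoint]
  exact marginalSum_congr fun y _ => hL y

/-- Padding with identities lets a one-leg insertion be composed with a gauge acting on a whole
boundary. -/
theorem matrixAct_singleton_eq {K : Finset ι} {e : ι} (he : e ∈ K)
    (M : ∀ i, Matrix (X i) (X i) ℂ) (f : (∀ i, X i) → ℂ) :
    matrixAct {e} M f = matrixAct K (Function.update (fun _ => 1) e (M e)) f := by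
  conv_rhs => rw [← Finset.insert_erase he, Finset.insert_eq,
    matrixAct_union (by simp)]
  rw [matrixAct_congr (K := K.erase e) (N := fun _ => 1), matrixAct_one]
  · exact matrixAct_congr (by simp) f
  · intro i hi
    rw [Function.update_of_ne (Finset.ne_of_mem_erase hi)]

end Action

/-! ### Injective tensors and their duals -/

section Injective

variable {ι : Type*} [Fintype ι] [DecidableEq ι] {X : ι → Type*} [∀ i, Fintype (X i)]
  {S : Type*}

/-- The tensor `f`, with virtual indices in `K` and physical index in `S`, is injective as a map
from the virtual to the physical space. -/
def TensorInjective (K : Finset ι) (f : (∀ i, X i) → S → ℂ) : Prop :=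
  ∀ (c : (∀ i, X i) → ℂ) (x : ∀ i, X i),
    (∀ s, marginalSum K (fun y => c y * f y s) x = 0) → c x = 0

/-- Injectivity in usable form: contracting the physical index with `g` replaces `f` by a delta on
its virtual indices. -/
theorem TensorInjective.exists_dual [Fintype S] [∀ i, Nonempty (X i)] {K : Finset ι}
    {f : (∀ i, X i) → S → ℂ} (hf : TensorInjective K f)
    (hd : ∀ s, DependsOn (fun x => f x s) (K : Set ι)) :
    ∃ g : (∀ i, X i) → S → ℂ, (∀ s, DependsOn (fun x => g x s) (K : Set ι)) ∧
      ∀ x y, ∑ s, g x s * f y s = kroneckerOn K x y := by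
  classical
  have hd' : ∀ s x y, (∀ i ∈ K, x i = y i) → f x s = f y s := fun s x y h => hd s h
  obtain ⟨x₀⟩ : Nonempty (∀ i, X i) := inferInstance
  let ext (p : ∀ i : {i // i ∈ K}, X i) : ∀ i, X i := fun i => if h : i ∈ K then p ⟨i, h⟩ else x₀ i
  have hext : ∀ (p : ∀ i : {i // i ∈ K}, X i) (i : {i // i ∈ K}), ext p i = p i := by
    intro p i
    simp [ext]
  let T : ((∀ i : {i // i ∈ K}, X i) → ℂ) →ₗ[ℂ] (S → ℂ) :=
    { toFun := fun c s => ∑ p, c p * f (ext p) s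
      map_add' := by
        intro c c'
        ext s
        simp [add_mul, Finset.sum_add_distrib]
      map_smul' := by
        intro r c
        ext s
        simp [Finset.mul_sum, mul_assoc] }
  have hT : LinearMap.ker T = ⊥ := by
    rw [LinearMap.ker_eq_bot']
    intro c hc
    ext p
    have := hf (fun y => c fun i => y i) (ext p) fun s => by
      rw [marginalSum_base_irrel (y := x₀),
        marginalSum_eq_sum_subtype K (· ∈ K) (fun _ => Iff.rfl)]
      · have hcs : ∑ q, c q * f (ext q) s = 0 := congrFun hc s
        refine (Finset.sum_congr (by ext; simp) fun q _ => ?_).trans hcs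
        congr 2
        ext i
        exact hext q i
      · intro y z hyz
        dsimp only
        rw [hd' s y z hyz, funext fun i : {i // i ∈ K} => hyz i i.2]
    simpa [hext] using this
  obtain ⟨L, hL⟩ := T.exists_leftInverse_of_injective hT
  -- The dual tensor is the matrix of the left inverse `L` in the standard basis.
  refine ⟨fun x s => L (Pi.single s 1) fun i => x i, fun s x y hxy => ?_, fun x y => ?_⟩
  · dsimp only
    rw [funext fun i : {i // i ∈ K} => hxy i i.2]
  · have h1 : ∑ s, L (Pi.single s 1) (fun i => x i) * f y s = L (f y) fun i => x i := by
      conv_rhs => rw [← Finset.univ_sum_single (f y)]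
      rw [map_sum, Finset.sum_apply]
      refine Finset.sum_congr rfl fun s _ => ?_
      have : (Pi.single s (f y s) : S → ℂ) = f y s • Pi.single s 1 := by
        rw [← Pi.single_smul, smul_eq_mul, mul_one]
      rw [this, map_smul, Pi.smul_apply, smul_eq_mul, mul_comm]
    have h2 : T (Pi.single (fun i => y i) 1) = f y := by
      ext s
      change ∑ p, (Pi.single (fun i : {i // i ∈ K} => y i) (1 : ℂ) : _ → ℂ) p * f (ext p) s = _
      rw [Finset.sum_eq_single fun i : {i // i ∈ K} => y i]
      · rw [Pi.single_eq_same, one_mul]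
        exact hd' s _ _ fun i hi => hext (fun i => y i) ⟨i, hi⟩
      · intro p _ hp
        rw [Pi.single_eq_of_ne hp, zero_mul]
      · simp
    rw [h1, ← h2, ← LinearMap.comp_apply, hL, LinearMap.id_apply]
    by_cases h : ∀ i ∈ K, x i = y i
    · have hxy : (fun i : {i // i ∈ K} => x i) = fun i : {i // i ∈ K} => y i :=
        funext fun i => h i i.2
      rw [kroneckerOn_of_eq h, hxy, Pi.single_eq_same]
    · have hne : (fun i : {i // i ∈ K} => x i) ≠ fun i : {i // i ∈ K} => y i := by
        intro H
        exact h fun i hi => congrFun H ⟨i, hi⟩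
      push Not at h
      obtain ⟨i, hi, hi'⟩ := h
      rw [kroneckerOn_of_ne hi hi', Pi.single_eq_of_ne hne]

variable [Fintype S] [∀ i, Nonempty (X i)]

theorem sum_mul_marginalSum_marginalSum {K L : Finset ι} (γ : S → ℂ) (c h : (∀ i, X i) → ℂ)
    (f : (∀ i, X i) → S → ℂ) (x : ∀ i, X i) :
    ∑ t, γ t * marginalSum K (fun y => c y * marginalSum L (fun z => h z * f z t) y) x =
      marginalSum K (fun y => c y * marginalSum L (fun z => h z * ∑ t, γ t * f z t) y) x := by
  simp only [Finset.mul_sum, marginalSum_sum]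
  refine Finset.sum_congr rfl fun t _ => ?_
  rw [← marginalSum_const_mul]
  refine marginalSum_congr fun y _ => ?_
  rw [← mul_assoc, mul_comm _ (c y), mul_assoc, ← marginalSum_const_mul]
  congr 1
  exact marginalSum_congr fun z _ => by ring

theorem sum_dual_mul_marginalSum {K L : Finset ι} {f g : (∀ i, X i) → S → ℂ}
    (hg : ∀ x y, ∑ s, g x s * f y s = kroneckerOn K x y) (c : (∀ i, X i) → ℂ) (x z : ∀ i, X i) :
    ∑ s, g x s * marginalSum L (fun y => c y * f y s) z =
      marginalSum L (fun y => c y * kroneckerOn K x y) z := by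
  simp only [← hg, Finset.mul_sum]
  rw [marginalSum_sum]
  refine Finset.sum_congr rfl fun s _ => ?_
  rw [← marginalSum_const_mul]
  exact marginalSum_congr fun y _ => by ring

/-- An injective tensor can be cancelled when only some of its virtual indices are contracted. -/
theorem TensorInjective.cancel_of_subset {K L : Finset ι} {f : (∀ i, X i) → S → ℂ}
    (hf : TensorInjective K f) (hd : ∀ s, DependsOn (fun x => f x s) (K : Set ι)) (hL : L ⊆ K)
    {c : (∀ i, X i) → ℂ} {x : ∀ i, X i}
    (h : ∀ s, marginalSum L (fun y => c y * f y s) x = 0) : c x = 0 := by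
  obtain ⟨g, -, hg⟩ := hf.exists_dual hd
  have := sum_dual_mul_marginalSum (L := L) hg c x x
  rw [marginalSum_mul_kroneckerOn hL] at this
  rw [← this]
  exact Finset.sum_eq_zero fun s _ => by rw [h s, mul_zero]

/-- Transposition moves `M` onto the coefficients `c`; injectivity of `f` kills the result, and `Nᵀ`
recovers `c`. -/
theorem TensorInjective.matrixAct [∀ i, DecidableEq (X i)] {K : Finset ι}
    {f : (∀ i, X i) → S → ℂ} (hf : TensorInjective K f) {M N : ∀ i, Matrix (X i) (X i) ℂ}
    (h : ∀ i ∈ K, M i * N i = 1) :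
    TensorInjective K fun x s => matrixAct K M (fun y => f y s) x := by
  intro c x hc
  have h0 : ∀ y, (∀ i ∉ K, y i = x i) → _root_.matrixAct K (fun i => (M i)ᵀ) c y = 0 := by
    intro y hy
    refine hf _ y fun s => ?_
    rw [← marginalSum_mul_matrixAct subset_rfl, marginalSum_base _ hy, hc s]
  have h1 : _root_.matrixAct K (fun i => (N i)ᵀ) (_root_.matrixAct K (fun i => (M i)ᵀ) c) x = 0 := by
    rw [_root_.matrixAct, marginalSum_congr (g := fun _ => 0 * 0), marginalSum_const_mul, zero_mul]
    intro y hy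
    rw [h0 y hy, mul_zero, mul_zero]
  rwa [matrixAct_cancel] at h1
  intro i hi
  rw [← Matrix.transpose_mul, h i hi, Matrix.transpose_one]

theorem TensorInjective.exists_ne_zero {K : Finset ι} {f : (∀ i, X i) → S → ℂ}
    (hf : TensorInjective K f) : ∃ x s, f x s ≠ 0 := by
  by_contra! h
  obtain ⟨x⟩ : Nonempty (∀ i, X i) := inferInstance
  refine one_ne_zero (α := ℂ) (hf (fun _ => 1) x fun s => ?_)
  rw [marginalSum_congr (g := fun _ => 0 * 0), marginalSum_const_mul, zero_mul]
  intro y _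
  rw [h y s, mul_zero, mul_zero]

end Injective

/-! ### Two decompositions of one bipartite state -/

section Bipartite

variable {ι : Type*} [Fintype ι] [DecidableEq ι] {X Y : ι → Type*} [∀ i, Fintype (X i)]
  [∀ i, Fintype (Y i)] [∀ i, Nonempty (X i)] [∀ i, Nonempty (Y i)] {S : Type*} [Fintype S]

/-- Two contractions `f₁ f₂` and `g₁ g₂` along the indices `K` that give the same bipartite state
are related by a matrix on the bond, if `f₁` and `g₂` are injective. -/
theorem exists_bond_matrix {K : Finset ι} {f₁ f₂ : (∀ i, X i) → S → ℂ}
    {g₁ g₂ : (∀ i, Y i) → S → ℂ}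
    (hdf₂ : ∀ s, DependsOn (fun x => f₂ x s) (K : Set ι))
    (hdg₂ : ∀ s, DependsOn (fun x => g₂ x s) (K : Set ι))
    (hf₁ : TensorInjective K f₁) (hg₂ : TensorInjective K g₂)
    (h : ∀ s t x y, marginalSum K (fun x => f₁ x s * f₂ x t) x =
      marginalSum K (fun y => g₁ y s * g₂ y t) y) :
    ∃ W : (∀ i, Y i) → (∀ i, X i) → ℂ,
      (∀ y, DependsOn (W y) (K : Set ι)) ∧ (∀ x, DependsOn (fun y => W y x) (K : Set ι)) ∧
      (∀ s y x, g₁ y s = marginalSum K (fun x => W y x * f₁ x s) x) ∧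
      ∀ t x y, f₂ x t = marginalSum K (fun y => W y x * g₂ y t) y := by
  obtain ⟨γ, hdγ, hγ⟩ := hg₂.exists_dual hdg₂
  have hWx : ∀ y : ∀ i, Y i, DependsOn (fun x => ∑ t, γ y t * f₂ x t) (K : Set ι) :=
    fun y x x' hx => Finset.sum_congr rfl fun t _ => by
      have := hdf₂ t hx
      dsimp only at this
      rw [this]
  have hWy : ∀ x : ∀ i, X i, DependsOn (fun y => ∑ t, γ y t * f₂ x t) (K : Set ι) :=
    fun x y y' hy => Finset.sum_congr rfl fun t _ => by
      have := hdγ t hy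
      dsimp only at this
      rw [this]
  -- `W` is the dual of `g₂` applied to `f₂`. Applying the same dual to the second half of both
  -- sides of `h` isolates `g₁`.
  have h1 : ∀ s y x, g₁ y s = marginalSum K (fun x => (∑ t, γ y t * f₂ x t) * f₁ x s) x := by
    intro s y x
    have e1 : ∑ t, γ y t * marginalSum K (fun z => g₁ z s * g₂ z t) y = g₁ y s := by
      rw [sum_dual_mul_marginalSum hγ, marginalSum_mul_kroneckerOn subset_rfl]
    rw [← e1]
    simp only [Finset.sum_mul]
    rw [marginalSum_sum]
    refine Finset.sum_congr rfl fun t _ => ?_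
    rw [← h s t x y, ← marginalSum_const_mul]
    exact marginalSum_congr fun z _ => by ring
  refine ⟨fun y x => ∑ t, γ y t * f₂ x t, hWx, hWy, h1, fun t x y => ?_⟩
  rw [← sub_eq_zero]
  -- The second relation follows by cancelling the injective `f₁` after substituting `g₁ = W f₁`.
  refine hf₁ (fun x => f₂ x t - marginalSum K (fun y => (∑ t, γ y t * f₂ x t) * g₂ y t) y) x
    fun s => ?_
  simp only [sub_mul]
  rw [marginalSum_sub, sub_eq_zero]
  have e2 := h s t x y
  simp only [mul_comm (f₁ _ _)] at e2
  rw [e2]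
  simp only [h1 s _ x, ← marginalSum_mul_const]
  rw [marginalSum_comm]
  refine marginalSum_congr fun x' _ => marginalSum_congr fun y' _ => ?_
  ring

variable {K : Finset ι} {f₁ f₂ : (∀ i, X i) → S → ℂ} {g₁ g₂ : (∀ i, Y i) → S → ℂ}
  {W : (∀ i, Y i) → (∀ i, X i) → ℂ} {e : ι}

/-- Together with `marginalSum_matrixAct_bond_right`, this writes insertions in both networks
between the same outer tensors `f₁` and `g₂`, so that they differ only in how the matrix acts on
`W`. -/
theorem marginalSum_matrixAct_bond_left [∀ i, DecidableEq (Y i)]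
    (hg : ∀ s y x, g₁ y s = marginalSum K (fun x => W y x * f₁ x s) x)
    (M : ∀ i, Matrix (Y i) (Y i) ℂ) (s t : S) (x : ∀ i, X i) (y : ∀ i, Y i) :
    marginalSum K (fun y => matrixAct {e} M (fun y => g₁ y s) y * g₂ y t) y =
      marginalSum K (fun y => marginalSum K
        (fun x => matrixAct {e} M (fun y => W y x) y * f₁ x s) x * g₂ y t) y := by
  refine marginalSum_congr fun y' _ => ?_
  congr 1
  simp only [hg s _ x, matrixAct_singleton, Finset.sum_mul]
  rw [marginalSum_sum]
  refine Finset.sum_congr rfl fun k _ => ?_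
  rw [← marginalSum_const_mul]
  exact marginalSum_congr fun x' _ => by ring

theorem marginalSum_matrixAct_bond_right [∀ i, DecidableEq (X i)]
    (hf : ∀ t x y, f₂ x t = marginalSum K (fun y => W y x * g₂ y t) y) (he : e ∈ K)
    (M : ∀ i, Matrix (X i) (X i) ℂ) (s t : S) (x : ∀ i, X i) (y : ∀ i, Y i) :
    marginalSum K (fun x => matrixAct {e} M (fun x => f₁ x s) x * f₂ x t) x =
      marginalSum K (fun y => marginalSum K
        (fun x => matrixAct {e} (fun i => (M i)ᵀ) (W y) x * f₁ x s) x * g₂ y t) y := by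
  simp only [hf t _ y, ← marginalSum_mul_const, ← marginalSum_const_mul]
  rw [marginalSum_comm]
  refine marginalSum_congr fun y' _ => ?_
  rw [marginalSum_mul_const, ← marginalSum_mul_matrixAct (Finset.singleton_subset_iff.2 he),
    ← marginalSum_mul_const]
  refine marginalSum_congr fun x' _ => ?_
  ring

end Bipartite

/-! ### Bond matrices that commute with every insertion -/

section Scalar

variable {ι : Type*} [Fintype ι] [DecidableEq ι] {X : ι → Type*} [∀ i, Fintype (X i)]
  [∀ i, DecidableEq (X i)] [∀ i, Nonempty (X i)] {S : Type*} [Fintype S]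

/-- A function of the configurations on `K` that is not changed by modifying one coordinate is
constant. -/
theorem eq_of_update_eq {α : Type*} {K : Finset ι} {w : (∀ i, X i) → α}
    (hd : DependsOn w (K : Set ι))
    (h : ∀ e ∈ K, ∀ x k, w (Function.update x e k) = w x) (x y : ∀ i, X i) : w x = w y := by
  have key : ∀ L ⊆ K, w (L.piecewise x y) = w y := by
    intro L
    induction L using Finset.induction_on with
    | empty => simp
    | insert e L he ih =>
      intro hL
      rw [Finset.piecewise_insert, h e (hL (Finset.mem_insert_self e L)),
        ih fun i hi => hL (Finset.mem_insert_of_mem hi)]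
  rw [← key K subset_rfl]
  exact hd fun i hi => by simp [Finset.mem_coe.1 hi]

/-- A matrix on the configurations on `K` that commutes with all matrices acting on a single
coordinate is a multiple of the identity. -/
theorem exists_eq_mul_kroneckerOn {K : Finset ι} {W : (∀ i, X i) → (∀ i, X i) → ℂ}
    (hd₁ : ∀ y, DependsOn (W y) (K : Set ι)) (hd₂ : ∀ x, DependsOn (fun y => W y x) (K : Set ι))
    (h : ∀ e ∈ K, ∀ (M : ∀ i, Matrix (X i) (X i) ℂ) y x,
      matrixAct {e} M (fun y => W y x) y = matrixAct {e} (fun i => (M i)ᵀ) (W y) x) :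
    ∃ c, ∀ y x, W y x = c * kroneckerOn K x y := by
  have hne : ∀ e ∈ K, ∀ y x : ∀ i, X i, x e ≠ y e → W y x = 0 := by
    intro e he y x hxy
    -- A diagonal matrix unit at `y e` keeps `W y x` on one side and annihilates it on the other.
    have := h e he (Function.update (fun _ => 0) e (Matrix.single (y e) (y e) 1)) y x
    simp only [matrixAct_singleton, Function.update_self, Matrix.transpose_apply,
      Matrix.single_apply] at this
    simpa [Ne.symm hxy] using this
  have heq : ∀ e ∈ K, ∀ (x : ∀ i, X i) (k : X e),
      W (Function.update x e k) (Function.update x e k) = W x x := by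
    intro e he x k
    -- The matrix unit from `k` to `x e` carries one diagonal entry to the other.
    have := h e he (Function.update (fun _ => 0) e (Matrix.single (x e) k 1)) x
      (Function.update x e k)
    simp only [matrixAct_singleton, Function.update_self, Matrix.transpose_apply,
      Matrix.single_apply] at this
    simpa using this
  obtain ⟨x₀⟩ : Nonempty (∀ i, X i) := inferInstance
  have hdiag : ∀ x, W x x = W x₀ x₀ := fun x => by
    refine eq_of_update_eq (K := K) (w := fun x => W x x) ?_ heq x x₀
    intro y z hyz
    dsimp only
    rw [hd₁ y hyz]
    exact hd₂ z hyz
  refine ⟨W x₀ x₀, fun y x => ?_⟩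
  by_cases hxy : ∀ i ∈ K, x i = y i
  · rw [kroneckerOn_of_eq hxy, mul_one, hd₁ y hxy, hdiag]
  · push Not at hxy
    obtain ⟨e, he, hne'⟩ := hxy
    rw [kroneckerOn_of_ne he hne', mul_zero, hne e he y x hne']

/-- If the insertion of any matrix on any single bond gives the same state, the two halves are
proportional. -/
theorem exists_proportional_of_insertions {K : Finset ι} {f₁ f₂ g₁ g₂ : (∀ i, X i) → S → ℂ}
    (hdf₂ : ∀ s, DependsOn (fun x => f₂ x s) (K : Set ι))
    (hdg₂ : ∀ s, DependsOn (fun x => g₂ x s) (K : Set ι))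
    (hf₁ : TensorInjective K f₁) (hg₁ : TensorInjective K g₁) (hg₂ : TensorInjective K g₂)
    (h : ∀ s t x y, marginalSum K (fun x => f₁ x s * f₂ x t) x =
      marginalSum K (fun y => g₁ y s * g₂ y t) y)
    (hins : ∀ e ∈ K, ∀ (M : ∀ i, Matrix (X i) (X i) ℂ) s t x y,
      marginalSum K (fun x => matrixAct {e} M (fun x => f₁ x s) x * f₂ x t) x =
      marginalSum K (fun y => matrixAct {e} M (fun y => g₁ y s) y * g₂ y t) y) :
    ∃ c : ℂ, c ≠ 0 ∧ ∀ x s, g₁ x s = c * f₁ x s := by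
  obtain ⟨W, hW₁, hW₂, hg, hf⟩ := exists_bond_matrix hdf₂ hdg₂ hf₁ hg₂ h
  obtain ⟨x₀⟩ : Nonempty (∀ i, X i) := inferInstance
  -- Cancelling `g₂` and then `f₁` reduces equality of the insertions to a commutation relation for
  -- `W`.
  have hcomm : ∀ e ∈ K, ∀ (M : ∀ i, Matrix (X i) (X i) ℂ) y x,
      matrixAct {e} M (fun y => W y x) y = matrixAct {e} (fun i => (M i)ᵀ) (W y) x := by
    intro e he M y x
    have h1 : ∀ s, marginalSum K
        (fun x => (matrixAct {e} M (fun y => W y x) y -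
          matrixAct {e} (fun i => (M i)ᵀ) (W y) x) * f₁ x s) x = 0 := by
      intro s
      refine hg₂ (fun y => marginalSum K (fun x => (matrixAct {e} M (fun y => W y x) y -
          matrixAct {e} (fun i => (M i)ᵀ) (W y) x) * f₁ x s) x) y fun t => ?_
      have := hins e he M s t x y
      rw [marginalSum_matrixAct_bond_right hf he, marginalSum_matrixAct_bond_left hg] at this
      simp only [sub_mul, marginalSum_sub]
      rw [this, sub_self]
    exact sub_eq_zero.1 (hf₁ (fun x => matrixAct {e} M (fun y => W y x) y -
      matrixAct {e} (fun i => (M i)ᵀ) (W y) x) x h1)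
  obtain ⟨c, hc⟩ := exists_eq_mul_kroneckerOn hW₁ hW₂ hcomm
  have hgf : ∀ x s, g₁ x s = c * f₁ x s := by
    intro x s
    rw [hg s x x]
    simp only [hc, kroneckerOn_comm _ _ x, mul_assoc]
    rw [marginalSum_const_mul]
    simp only [mul_comm (kroneckerOn K x _)]
    rw [marginalSum_mul_kroneckerOn subset_rfl]
  refine ⟨c, ?_, hgf⟩
  rintro rfl
  obtain ⟨x, s, hx⟩ := hg₁.exists_ne_zero
  exact hx (by rw [hgf, zero_mul])

end Scalar

/-! ### Oriented graphs and the edges of a region -/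

/-- Edges `ι` with their two distinct endpoints in `V`. -/
structure EdgeEnds (ι V : Type*) where
  tail : ι → V
  head : ι → V
  tail_ne_head : ∀ e, tail e ≠ head e

namespace EdgeEnds

variable {ι V : Type*} [Fintype ι] [DecidableEq ι] [Fintype V] [DecidableEq V] (E : EdgeEnds ι V)

/-- The edges with both endpoints in `R`. -/
def interior (R : Finset V) : Finset ι := {e | E.tail e ∈ R ∧ E.head e ∈ R}

/-- The edges with exactly one endpoint in `R`. -/
def boundary (R : Finset V) : Finset ι :=
  {e | E.tail e ∈ R ∧ E.head e ∉ R ∨ E.tail e ∉ R ∧ E.head e ∈ R}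

/-- The edges with one endpoint in `R` and the other one in `S`. -/
def between (R S : Finset V) : Finset ι :=
  {e | E.tail e ∈ R ∧ E.head e ∈ S ∨ E.tail e ∈ S ∧ E.head e ∈ R}

/-- The edges with at least one endpoint in `R`. -/
def touching (R : Finset V) : Set ι := {e | E.tail e ∈ R ∨ E.head e ∈ R}

variable {E} {R S : Finset V} {e : ι}

@[simp]
theorem mem_interior : e ∈ E.interior R ↔ E.tail e ∈ R ∧ E.head e ∈ R := by simp [interior]

@[simp]
theorem mem_boundary : e ∈ E.boundary R ↔
    E.tail e ∈ R ∧ E.head e ∉ R ∨ E.tail e ∉ R ∧ E.head e ∈ R := by simp [boundary]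

@[simp]
theorem mem_between : e ∈ E.between R S ↔
    E.tail e ∈ R ∧ E.head e ∈ S ∨ E.tail e ∈ S ∧ E.head e ∈ R := by simp [between]

@[simp]
theorem mem_touching : e ∈ E.touching R ↔ E.tail e ∈ R ∨ E.head e ∈ R := Iff.rfl

theorem touching_eq : E.touching R = (E.boundary R : Set ι) ∪ (E.interior R : Set ι) := by
  ext e
  simp only [mem_touching, Set.mem_union, Finset.mem_coe, mem_boundary, mem_interior]
  tauto

@[simp]
theorem interior_empty : E.interior ∅ = ∅ := by ext; simp

@[simp]
theorem boundary_empty : E.boundary ∅ = ∅ := by ext; simp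

@[simp]
theorem boundary_univ : E.boundary Finset.univ = ∅ := by ext; simp

@[simp]
theorem interior_singleton (v : V) : E.interior {v} = ∅ := by
  ext e
  simp only [mem_interior, Finset.mem_singleton, Finset.notMem_empty, iff_false, not_and]
  rintro rfl h
  exact E.tail_ne_head e h.symm

theorem boundary_compl : E.boundary Rᶜ = E.boundary R := by
  ext e
  simp only [mem_boundary, Finset.mem_compl]
  tauto

theorem between_compl : E.between R Rᶜ = E.boundary R := by
  ext e
  simp only [mem_boundary, mem_between, Finset.mem_compl]

theorem between_comm : E.between R S = E.between S R := by
  ext e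
  simp only [mem_between]
  tauto

section Disjoint

variable (h : Disjoint R S)
include h

theorem interior_union :
    E.interior (R ∪ S) = E.between R S ∪ (E.interior R ∪ E.interior S) := by
  ext e
  simp only [mem_between, Finset.mem_union, mem_interior]
  tauto

theorem disjoint_between_interior :
    Disjoint (E.between R S) (E.interior R ∪ E.interior S) := by
  rw [Finset.disjoint_left]
  intro e
  have h1 : E.tail e ∈ R → E.tail e ∉ S := fun h' => Finset.disjoint_left.1 h h'
  have h2 : E.head e ∈ R → E.head e ∉ S := fun h' => Finset.disjoint_left.1 h h'
  simp only [mem_between, Finset.mem_union, mem_interior]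
  tauto

theorem disjoint_interior : Disjoint (E.interior R) (E.interior S) := by
  rw [Finset.disjoint_left]
  intro e
  have h1 : E.tail e ∈ R → E.tail e ∉ S := fun h' => Finset.disjoint_left.1 h h'
  simp only [mem_interior]
  tauto

theorem disjoint_touching_interior : Disjoint (E.touching R) (E.interior S : Set ι) := by
  rw [Set.disjoint_left]
  intro e
  have h1 : E.tail e ∈ R → E.tail e ∉ S := fun h' => Finset.disjoint_left.1 h h'
  have h2 : E.head e ∈ R → E.head e ∉ S := fun h' => Finset.disjoint_left.1 h h'
  simp only [mem_touching, Finset.mem_coe, mem_interior]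
  tauto

theorem between_subset_boundary : E.between R S ⊆ E.boundary R := by
  intro e
  have h1 : E.tail e ∈ R → E.tail e ∉ S := fun h' => Finset.disjoint_left.1 h h'
  have h2 : E.head e ∈ R → E.head e ∉ S := fun h' => Finset.disjoint_left.1 h h'
  simp only [mem_between, mem_boundary]
  tauto

theorem boundary_union :
    E.boundary (R ∪ S) = E.boundary R \ E.between R S ∪ E.boundary S \ E.between R S := by
  ext e
  have h1 : E.tail e ∈ R → E.tail e ∉ S := fun h' => Finset.disjoint_left.1 h h'
  have h2 : E.head e ∈ R → E.head e ∉ S := fun h' => Finset.disjoint_left.1 h h'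
  simp only [mem_between, mem_boundary, Finset.mem_union, Finset.mem_sdiff]
  tauto

theorem disjoint_boundary_sdiff_between :
    Disjoint (E.boundary R \ E.between R S) (E.boundary S) := by
  rw [Finset.disjoint_left]
  intro e
  have h1 : E.tail e ∈ R → E.tail e ∉ S := fun h' => Finset.disjoint_left.1 h h'
  have h2 : E.head e ∈ R → E.head e ∉ S := fun h' => Finset.disjoint_left.1 h h'
  simp only [mem_between, mem_boundary, Finset.mem_sdiff]
  tauto

end Disjoint

end EdgeEnds

/-! ### Tensor networks, blocking and injective regions -/

section Network

variable {ι V : Type*} [Fintype ι] [DecidableEq ι] [Fintype V] [DecidableEq V]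
  {X : ι → Type*} [∀ i, Fintype (X i)] {T : V → Type*}

/-- The tensor at every vertex only depends on the virtual indices of the incident edges. -/
def IsLocalNetwork (E : EdgeEnds ι V) (a : ∀ v, (∀ i, X i) → T v → ℂ) : Prop :=
  ∀ v s, DependsOn (fun x => a v x s) (E.boundary {v} : Set ι)

/-- The blocked tensor of the region `R`, as a function of all virtual and physical indices. -/
noncomputable def blockTensor (E : EdgeEnds ι V) (a : ∀ v, (∀ i, X i) → T v → ℂ) (R : Finset V)
    (x : ∀ i, X i) (s : ∀ v, T v) : ℂ :=
  marginalSum (E.interior R) (fun y => ∏ v ∈ R, a v y (s v)) x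

variable {E : EdgeEnds ι V} {a : ∀ v, (∀ i, X i) → T v → ℂ} {R S : Finset V}

theorem IsLocalNetwork.prod_dependsOn (ha : IsLocalNetwork E a) (R : Finset V) (s : ∀ v, T v) :
    DependsOn (fun x => ∏ v ∈ R, a v x (s v)) (E.touching R) := by
  intro x y h
  refine Finset.prod_congr rfl fun v hv => ha v (s v) fun e he => h e ?_
  have := E.tail_ne_head e
  simp only [Finset.mem_coe, EdgeEnds.mem_boundary, Finset.mem_singleton] at he
  rw [EdgeEnds.mem_touching]
  rcases he with ⟨rfl, -⟩ | ⟨-, rfl⟩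
  · exact Or.inl hv
  · exact Or.inr hv

theorem IsLocalNetwork.blockTensor_dependsOn (ha : IsLocalNetwork E a) (R : Finset V)
    (s : ∀ v, T v) : DependsOn (fun x => blockTensor E a R x s) (E.boundary R : Set ι) :=
  marginalSum_dependsOn (by rw [← EdgeEnds.touching_eq]; exact ha.prod_dependsOn R s)

theorem blockTensor_congr_phys {s t : ∀ v, T v} (h : ∀ v ∈ R, s v = t v) (x : ∀ i, X i) :
    blockTensor E a R x s = blockTensor E a R x t :=
  marginalSum_congr fun y _ => Finset.prod_congr rfl fun v hv => by rw [h v hv]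

/-- Edges inside one region do not touch the other, so the inner sums factor and only the edges
between the regions remain to be contracted. -/
theorem blockTensor_union (ha : IsLocalNetwork E a) (h : Disjoint R S) (x : ∀ i, X i)
    (s : ∀ v, T v) :
    blockTensor E a (R ∪ S) x s =
      marginalSum (E.between R S) (fun y => blockTensor E a R y s * blockTensor E a S y s) x := by
  unfold blockTensor
  rw [EdgeEnds.interior_union h, marginalSum_union (EdgeEnds.disjoint_between_interior h)]
  refine marginalSum_congr fun y _ => ?_
  rw [marginalSum_union (EdgeEnds.disjoint_interior h)]
  simp only [Finset.prod_union h]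
  have h1 : marginalSum (E.interior S)
      (fun y => (∏ v ∈ R, a v y (s v)) * ∏ v ∈ S, a v y (s v)) =
      fun y => (∏ v ∈ R, a v y (s v)) *
        marginalSum (E.interior S) (fun y => ∏ v ∈ S, a v y (s v)) y :=
    funext fun y => marginalSum_mul_left (ha.prod_dependsOn R s)
      (EdgeEnds.disjoint_touching_interior h) _ y
  rw [h1]
  refine marginalSum_mul_right (S := E.touching S) ?_
    (EdgeEnds.disjoint_touching_interior h.symm) _ y
  refine (ha.blockTensor_dependsOn S s).mono ?_
  rw [EdgeEnds.touching_eq]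
  exact Set.subset_union_left

theorem blockTensor_empty (x : ∀ i, X i) (s : ∀ v, T v) : blockTensor E a ∅ x s = 1 := by
  simp [blockTensor]

theorem blockTensor_singleton (v : V) (x : ∀ i, X i) (s : ∀ v, T v) :
    blockTensor E a {v} x s = a v x (s v) := by
  simp [blockTensor]

theorem marginalSum_blockTensor_mul (ha : IsLocalNetwork E a) (h : Disjoint R S) (x : ∀ i, X i)
    (s t : ∀ v, T v) :
    marginalSum (E.between R S) (fun y => blockTensor E a R y s * blockTensor E a S y t) x =
      blockTensor E a (R ∪ S) x (R.piecewise s t) := by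
  rw [blockTensor_union ha h]
  refine marginalSum_congr fun y _ => ?_
  congr 1
  · exact blockTensor_congr_phys (fun v hv => by simp [hv]) y
  · exact blockTensor_congr_phys (fun v hv => by simp [Finset.disjoint_right.1 h hv]) y

theorem marginalSum_blockTensor_mul_compl (ha : IsLocalNetwork E a) (R : Finset V)
    (x : ∀ i, X i) (s t : ∀ v, T v) :
    marginalSum (E.boundary R) (fun y => blockTensor E a R y s * blockTensor E a Rᶜ y t) x =
      blockTensor E a Finset.univ x (R.piecewise s t) := by
  rw [← EdgeEnds.between_compl, marginalSum_blockTensor_mul ha disjoint_compl_right,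
    Finset.union_compl]

/-- The region `R` is injective for the network `a`. -/
def InjectiveRegion (E : EdgeEnds ι V) (a : ∀ v, (∀ i, X i) → T v → ℂ) (R : Finset V) : Prop :=
  TensorInjective (E.boundary R) (blockTensor E a R)

/-- The physical indices of disjoint regions vary independently, so both duals can be applied. They
leave deltas on the two boundaries; contracting the common edges collapses these to a delta on the
boundary of the union. -/
theorem InjectiveRegion.union [∀ v, Fintype (T v)] [∀ i, Nonempty (X i)]
    (ha : IsLocalNetwork E a) (h : Disjoint R S)
    (hR : InjectiveRegion E a R) (hS : InjectiveRegion E a S) : InjectiveRegion E a (R ∪ S) := by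
  obtain ⟨g₁, -, hg₁⟩ := hR.exists_dual (ha.blockTensor_dependsOn R)
  obtain ⟨g₂, -, hg₂⟩ := hS.exists_dual (ha.blockTensor_dependsOn S)
  intro c x hc
  have key : ∑ s, g₁ x s * ∑ t, g₂ x t * marginalSum (E.boundary (R ∪ S))
      (fun y => c y * blockTensor E a (R ∪ S) y (R.piecewise s t)) x = 0 :=
    Finset.sum_eq_zero fun s _ => by
      rw [Finset.sum_eq_zero fun t _ => by rw [hc, mul_zero], mul_zero]
  simp only [← marginalSum_blockTensor_mul ha h, sum_mul_marginalSum_marginalSum, hg₂] at key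
  simp only [mul_comm _ (kroneckerOn (E.boundary S) _ _), sum_mul_marginalSum_marginalSum,
    hg₁] at key
  rw [← key]
  refine (marginalSum_mul_kroneckerOn subset_rfl c x).symm.trans
    (marginalSum_congr fun y hy => ?_)
  congr 1
  by_cases hxy : ∀ i ∈ E.boundary (R ∪ S), x i = y i
  · have : y = x := funext fun i => by
      by_cases hi : i ∈ E.boundary (R ∪ S)
      · exact (hxy i hi).symm
      · exact hy i hi
    subst this
    rw [kroneckerOn_of_eq hxy,
      marginalSum_mul_kroneckerOn (EdgeEnds.between_subset_boundary h),
      kroneckerOn_of_eq fun _ _ => rfl]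
  · push Not at hxy
    obtain ⟨e, he, hne⟩ := hxy
    rw [kroneckerOn_of_ne he hne, marginalSum_congr (g := fun _ => 0 * 0),
      marginalSum_const_mul, zero_mul]
    intro z hz
    rw [EdgeEnds.boundary_union h, Finset.mem_union, Finset.mem_sdiff, Finset.mem_sdiff] at he
    rcases he with he | he
    · rw [kroneckerOn_of_ne he.1 (by rwa [hz e he.2]), mul_zero, mul_zero]
    · rw [kroneckerOn_of_ne he.1 (by rwa [hz e he.2]), zero_mul, mul_zero]

end Network

/-! ### Inserting a matrix on an edge -/

section Insertion

variable {ι V : Type*} [Fintype ι] [DecidableEq ι] [Fintype V] [DecidableEq V]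
  {X : ι → Type*} [∀ i, Fintype (X i)] [∀ i, DecidableEq (X i)] {T : V → Type*}
  {E : EdgeEnds ι V} {a : ∀ v, (∀ i, X i) → T v → ℂ} {R S : Finset V} {e : ι}

/-- The network with the matrix `M e` inserted on the edge `e`. -/
noncomputable def insertMatrix (E : EdgeEnds ι V) (a : ∀ v, (∀ i, X i) → T v → ℂ) (e : ι)
    (M : ∀ i, Matrix (X i) (X i) ℂ) (v : V) (x : ∀ i, X i) (s : T v) : ℂ :=
  if v = E.tail e then matrixAct {e} M (fun y => a v y s) x else a v x s

theorem IsLocalNetwork.insertMatrix (ha : IsLocalNetwork E a) (e : ι)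
    (M : ∀ i, Matrix (X i) (X i) ℂ) : IsLocalNetwork E (insertMatrix E a e M) := by
  intro v s
  unfold _root_.insertMatrix
  split_ifs with h
  · refine matrixAct_dependsOn ?_ (ha v s) M
    have := E.tail_ne_head e
    simp [h, this.symm]
  · exact ha v s

theorem blockTensor_insertMatrix_of_notMem (h : E.tail e ∉ R) (M : ∀ i, Matrix (X i) (X i) ℂ)
    (x : ∀ i, X i) (s : ∀ v, T v) :
    blockTensor E (insertMatrix E a e M) R x s = blockTensor E a R x s :=
  marginalSum_congr fun y _ => Finset.prod_congr rfl fun v hv => by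
    rw [insertMatrix, if_neg]
    rintro rfl
    exact h hv

theorem blockTensor_insertMatrix_of_mem (ha : IsLocalNetwork E a) (ht : E.tail e ∈ R)
    (hh : E.head e ∉ R) (M : ∀ i, Matrix (X i) (X i) ℂ) (s : ∀ v, T v) :
    (fun x => blockTensor E (insertMatrix E a e M) R x s) =
      matrixAct {e} M (fun x => blockTensor E a R x s) := by
  have h1 : (fun x => ∏ v ∈ R, insertMatrix E a e M v x (s v)) =
      matrixAct {e} M (fun x => ∏ v ∈ R, a v x (s v)) := by
    have h2 : (fun x => ∏ v ∈ R, a v x (s v)) =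
        fun x => a (E.tail e) x (s (E.tail e)) * ∏ v ∈ R.erase (E.tail e), a v x (s v) :=
      funext fun x => (Finset.mul_prod_erase R (fun v => a v x (s v)) ht).symm
    rw [h2, matrixAct_mul_right (ha.prod_dependsOn (R.erase (E.tail e)) s)
      (by simp [hh])]
    ext x
    rw [← Finset.mul_prod_erase R _ ht]
    congr 1
    · simp [insertMatrix]
    · exact Finset.prod_congr rfl fun v hv => by
        rw [insertMatrix, if_neg (Finset.ne_of_mem_erase hv)]
  have h3 := marginalSum_matrixAct (K := {e}) (L := E.interior R) (by simp [hh]) M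
    (fun x => ∏ v ∈ R, a v x (s v))
  rw [← h1] at h3
  exact h3

/-- The insertion sits at the tail. If the tail lies outside `R`, moving the matrix across the cut
to the `R` side transposes it. -/
theorem blockTensor_insertMatrix_univ (ha : IsLocalNetwork E a) (he : e ∈ E.boundary R)
    (M : ∀ i, Matrix (X i) (X i) ℂ) (x : ∀ i, X i) (s t : ∀ v, T v) :
    blockTensor E (insertMatrix E a e M) Finset.univ x (R.piecewise s t) =
      marginalSum (E.boundary R) (fun y =>
        matrixAct {e} (if E.tail e ∈ R then M else fun i => (M i)ᵀ)
          (fun y => blockTensor E a R y s) y * blockTensor E a Rᶜ y t) x := by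
  rw [← marginalSum_blockTensor_mul_compl (ha.insertMatrix e M)]
  have heb : {e} ⊆ E.boundary R := by rwa [Finset.singleton_subset_iff]
  rcases EdgeEnds.mem_boundary.1 he with ⟨ht, hh⟩ | ⟨ht, hh⟩
  · simp only [if_pos ht, ← blockTensor_insertMatrix_of_mem ha ht hh,
      blockTensor_insertMatrix_of_notMem (R := Rᶜ) (E := E) (e := e) (by simpa using ht)]
  · simp only [if_neg ht]
    rw [← marginalSum_mul_matrixAct heb]
    simp only [blockTensor_insertMatrix_of_notMem ht,
      ← blockTensor_insertMatrix_of_mem ha (R := Rᶜ) (by simpa using ht) (by simpa using hh)]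

end Insertion

/-! ### The action of a gauge on blocked tensors -/

section Gauge

variable {ι V : Type*} [Fintype ι] [DecidableEq ι] [Fintype V] [DecidableEq V]
  {X : ι → Type*} [∀ i, Fintype (X i)] [∀ i, DecidableEq (X i)] {T : V → Type*}
  {E : EdgeEnds ι V} {a : ∀ v, (∀ i, X i) → T v → ℂ} {R S : Finset V} {e : ι}

/-- The matrices with which the gauge `Z` acts on the boundary of a region. -/
def gaugeMatrix (E : EdgeEnds ι V) (Z : ∀ i, GL (X i) ℂ) (R : Finset V) (i : ι) :
    Matrix (X i) (X i) ℂ :=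
  if E.tail i ∈ R then (Z i).valᵀ else ((Z i)⁻¹).val

/-- The network obtained by the action of the gauge `Z`. -/
noncomputable def gaugeNetwork (E : EdgeEnds ι V) (Z : ∀ i, GL (X i) ℂ)
    (a : ∀ v, (∀ i, X i) → T v → ℂ) (v : V) (x : ∀ i, X i) (s : T v) : ℂ :=
  matrixAct (E.boundary {v}) (gaugeMatrix E Z {v}) (fun y => a v y s) x

theorem IsLocalNetwork.gaugeNetwork (ha : IsLocalNetwork E a) (Z : ∀ i, GL (X i) ℂ) :
    IsLocalNetwork E (gaugeNetwork E Z a) :=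
  fun v s => matrixAct_dependsOn subset_rfl (ha v s) _

theorem gaugeMatrix_transpose_mul (Z : ∀ i, GL (X i) ℂ) (h : Disjoint R S)
    (he : e ∈ E.between R S) : (gaugeMatrix E Z R e)ᵀ * gaugeMatrix E Z S e = 1 := by
  unfold gaugeMatrix
  rcases EdgeEnds.mem_between.1 he with ⟨ht, hh⟩ | ⟨ht, hh⟩
  · rw [if_pos ht, if_neg (Finset.disjoint_left.1 h ht), Matrix.transpose_transpose,
      ← Units.val_mul, mul_inv_cancel, Units.val_one]
  · rw [if_pos ht, if_neg (Finset.disjoint_right.1 h ht), ← Matrix.transpose_mul,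
      ← Units.val_mul, mul_inv_cancel, Units.val_one, Matrix.transpose_one]

theorem gaugeMatrix_union_left (Z : ∀ i, GL (X i) ℂ)
    (he : e ∈ E.boundary R \ E.between R S) :
    gaugeMatrix E Z (R ∪ S) e = gaugeMatrix E Z R e := by
  unfold gaugeMatrix
  simp only [Finset.mem_sdiff, EdgeEnds.mem_boundary, EdgeEnds.mem_between] at he
  refine if_congr ?_ rfl rfl
  rw [Finset.mem_union]
  tauto

/-- On each edge between the regions the gauge matrices of the two ends cancel
(`gaugeMatrix_transpose_mul`). Those on the remaining boundary edges commute with the contraction.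
-/
theorem blockTensor_gaugeNetwork_union (ha : IsLocalNetwork E a) (Z : ∀ i, GL (X i) ℂ)
    (h : Disjoint R S) (s : ∀ v, T v)
    (hR : (fun x => blockTensor E (gaugeNetwork E Z a) R x s) =
      matrixAct (E.boundary R) (gaugeMatrix E Z R) (fun x => blockTensor E a R x s))
    (hS : (fun x => blockTensor E (gaugeNetwork E Z a) S x s) =
      matrixAct (E.boundary S) (gaugeMatrix E Z S) (fun x => blockTensor E a S x s)) :
    (fun x => blockTensor E (gaugeNetwork E Z a) (R ∪ S) x s) =
      matrixAct (E.boundary (R ∪ S)) (gaugeMatrix E Z (R ∪ S))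
        (fun x => blockTensor E a (R ∪ S) x s) := by
  have hS' := EdgeEnds.between_subset_boundary (E := E) h.symm
  rw [EdgeEnds.between_comm] at hS'
  have hR' := EdgeEnds.between_subset_boundary (E := E) h
  have hdS := EdgeEnds.disjoint_boundary_sdiff_between (E := E) h.symm
  rw [EdgeEnds.between_comm] at hdS
  have hdR := EdgeEnds.disjoint_boundary_sdiff_between (E := E) h
  have h1 : (fun x => blockTensor E (gaugeNetwork E Z a) (R ∪ S) x s) =
      marginalSum (E.between R S) (fun y =>
        (fun x => blockTensor E (gaugeNetwork E Z a) R x s) y *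
        (fun x => blockTensor E (gaugeNetwork E Z a) S x s) y) :=
    funext fun x => blockTensor_union (ha.gaugeNetwork Z) h x s
  have h2 : (fun x => blockTensor E a (R ∪ S) x s) =
      marginalSum (E.between R S) (fun y => blockTensor E a R y s * blockTensor E a S y s) :=
    funext fun x => blockTensor_union ha h x s
  rw [h1, hR, hS, h2]
  set K := E.between R S
  set K₁ := E.boundary R \ K
  set K₂ := E.boundary S \ K
  set f := fun x => blockTensor E a R x s with hf
  set g := fun x => blockTensor E a S x s with hg
  have hfd : DependsOn f (E.boundary R : Set ι) := ha.blockTensor_dependsOn R s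
  have hgd : DependsOn g (E.boundary S : Set ι) := ha.blockTensor_dependsOn S s
  have hf1 : matrixAct (E.boundary R) (gaugeMatrix E Z R) f =
      matrixAct K₁ (gaugeMatrix E Z (R ∪ S)) (matrixAct K (gaugeMatrix E Z R) f) := by
    conv_lhs => rw [← Finset.sdiff_union_of_subset hR',
      matrixAct_union Finset.sdiff_disjoint]
    exact matrixAct_congr (fun i hi => (gaugeMatrix_union_left Z hi).symm) _
  have hg1 : matrixAct (E.boundary S) (gaugeMatrix E Z S) g =
      matrixAct K₂ (gaugeMatrix E Z (R ∪ S)) (matrixAct K (gaugeMatrix E Z S) g) := by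
    conv_lhs => rw [← Finset.sdiff_union_of_subset hS',
      matrixAct_union Finset.sdiff_disjoint]
    refine matrixAct_congr (fun i hi => ?_) _
    rw [Finset.union_comm, gaugeMatrix_union_left Z]
    rwa [EdgeEnds.between_comm]
  have hfd1 : DependsOn (matrixAct K (gaugeMatrix E Z R) f) (E.boundary R : Set ι) :=
    matrixAct_dependsOn (by exact_mod_cast hR') hfd _
  have hgd1 : DependsOn (matrixAct (E.boundary S) (gaugeMatrix E Z S) g)
      (E.boundary S : Set ι) := matrixAct_dependsOn subset_rfl hgd _
  have hK₁ : Disjoint K₁ K := Finset.sdiff_disjoint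
  have hK₂ : Disjoint K₂ K := Finset.sdiff_disjoint
  rw [hf1, ← matrixAct_mul_right hgd1 (by exact_mod_cast hdR.symm), marginalSum_matrixAct hK₁,
    hg1, ← matrixAct_mul_left hfd1 (by exact_mod_cast hdS.symm), marginalSum_matrixAct hK₂,
    EdgeEnds.boundary_union h, matrixAct_union]
  · congr 2
    ext x
    have := marginalSum_mul_matrixAct (subset_refl K) (fun i => (gaugeMatrix E Z R i)ᵀ) f
      (matrixAct K (gaugeMatrix E Z S) g) x
    simp only [Matrix.transpose_transpose] at this
    rw [← this, matrixAct_cancel fun i hi => gaugeMatrix_transpose_mul Z h hi]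
  · exact hdR.mono_right Finset.sdiff_subset

theorem blockTensor_gaugeNetwork (ha : IsLocalNetwork E a) (Z : ∀ i, GL (X i) ℂ)
    (R : Finset V) (s : ∀ v, T v) :
    (fun x => blockTensor E (gaugeNetwork E Z a) R x s) =
      matrixAct (E.boundary R) (gaugeMatrix E Z R) (fun x => blockTensor E a R x s) := by
  induction R using Finset.induction_on with
  | empty => simp [blockTensor_empty]
  | insert v R hv ih =>
    rw [Finset.insert_eq]
    refine blockTensor_gaugeNetwork_union ha Z (by simpa using hv) s ?_ ih
    simp only [blockTensor_singleton]
    rfl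

theorem InjectiveRegion.gaugeNetwork [∀ v, Fintype (T v)] [∀ i, Nonempty (X i)]
    (ha : IsLocalNetwork E a) (Z : ∀ i, GL (X i) ℂ) (hR : InjectiveRegion E a R) :
    InjectiveRegion E (gaugeNetwork E Z a) R := by
  have := TensorInjective.matrixAct hR (M := gaugeMatrix E Z R)
    -- The gauge matrices on the far side of the cut, transposed, invert those on the near side.
    (N := fun i => (gaugeMatrix E Z Rᶜ i)ᵀ) fun i hi => by
      have h := gaugeMatrix_transpose_mul Z (disjoint_compl_right (a := R))
        (by rwa [EdgeEnds.between_compl])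
      rw [← Matrix.transpose_inj, Matrix.transpose_mul, Matrix.transpose_transpose,
        Matrix.transpose_one]
      rw [_root_.mul_eq_one_comm] at h
      exact h
  intro c x h
  refine this c x fun s => ?_
  rw [← h s]
  simp only [← blockTensor_gaugeNetwork ha Z R]

theorem blockTensor_gaugeNetwork_univ (ha : IsLocalNetwork E a) (Z : ∀ i, GL (X i) ℂ)
    (x : ∀ i, X i) (s : ∀ v, T v) :
    blockTensor E (gaugeNetwork E Z a) Finset.univ x s = blockTensor E a Finset.univ x s := by
  have := congrFun (blockTensor_gaugeNetwork ha Z Finset.univ s) x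
  simpa using this

/-- Cut around the tail of `e`. Moving the gauge of the complement across cancels it on every cut
edge except `e`, where it conjugates `M`. -/
theorem blockTensor_insertMatrix_gaugeNetwork (ha : IsLocalNetwork E a) (Z : ∀ i, GL (X i) ℂ)
    (e : ι) (M : ∀ i, Matrix (X i) (X i) ℂ) (x : ∀ i, X i) (s : ∀ v, T v) :
    blockTensor E (insertMatrix E (gaugeNetwork E Z a) e M) Finset.univ x s =
      blockTensor E (insertMatrix E a e fun i => ((Z i)⁻¹).valᵀ * M i * (Z i).valᵀ)
        Finset.univ x s := by
  have he : e ∈ E.boundary {E.tail e} := by simp [(E.tail_ne_head e).symm]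
  have ht : E.tail e ∈ ({E.tail e} : Finset V) := Finset.mem_singleton_self _
  generalize hR : ({E.tail e} : Finset V) = R at he ht
  have h1 := blockTensor_insertMatrix_univ (ha.gaugeNetwork Z) he M x s s
  have h2 := blockTensor_insertMatrix_univ ha he
    (fun i => ((Z i)⁻¹).valᵀ * M i * (Z i).valᵀ) x s s
  simp only [Finset.piecewise_same, if_pos ht] at h1 h2
  rw [h1, h2, blockTensor_gaugeNetwork ha Z R s]
  simp only [fun y => congrFun (blockTensor_gaugeNetwork ha Z Rᶜ s) y,
    EdgeEnds.boundary_compl]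
  rw [marginalSum_mul_matrixAct subset_rfl, matrixAct_singleton_eq he, matrixAct_mul,
    matrixAct_mul, matrixAct_singleton_eq he]
  congr 1
  ext y
  congr 1
  refine congrFun (matrixAct_congr (fun i hi => ?_) _) y
  have hg := gaugeMatrix_transpose_mul Z (disjoint_compl_left (a := R))
    (by rwa [EdgeEnds.between_comm, EdgeEnds.between_compl])
  by_cases hie : i = e
  · subst hie
    rw [Function.update_self, Function.update_self, gaugeMatrix, gaugeMatrix, if_pos ht,
      if_neg (by simpa using ht), Matrix.mul_assoc]
  · rw [Function.update_of_ne hie, Function.update_of_ne hie, Matrix.mul_one]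
    exact hg

end Gauge

/-! ### Factorization of the bond matrix over a single edge -/

section BondFactorization

variable {ι : Type*} [Fintype ι] [DecidableEq ι] {X Y : ι → Type*} [∀ i, Fintype (X i)]
  [∀ i, Fintype (Y i)] {S : Type*} [Fintype S]

variable [∀ i, DecidableEq (X i)] [∀ i, Nonempty (X i)]

/-- The deltas overlap only at `e`: contracting `e` forces `x₁` and `x₂` to agree there, and the
other legs evaluate `c` at the merged configuration. -/
theorem marginalSum_mul_kroneckerOn_mul {K₁ K₂ : Finset ι} {e : ι} (hK : K₁ ∩ K₂ = {e})
    {c : (∀ i, X i) → ℂ} (hc : DependsOn c (K₁.erase e ∪ K₂.erase e : Finset ι))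
    (x₁ x₂ x : ∀ i, X i) :
    marginalSum (K₁.erase e ∪ K₂.erase e) (fun y => c y *
      marginalSum {e} (fun z => kroneckerOn K₁ x₁ z * kroneckerOn K₂ x₂ z) y) x =
      if x₁ e = x₂ e then c (K₁.piecewise x₁ x₂) else 0 := by
  have heK : e ∈ K₁ ∩ K₂ := by simp [hK]
  rw [Finset.mem_inter] at heK
  have hK' : ∀ i, i ∈ K₁ → i ∈ K₂ → i = e := fun i h1 h2 => by
    rw [← Finset.mem_singleton, ← hK]
    exact Finset.mem_inter.2 ⟨h1, h2⟩
  have hde : Disjoint (K₁.erase e ∪ K₂.erase e) {e} := by simp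
  split_ifs with he
  · have h1 : ∀ z, kroneckerOn K₁ x₁ z * kroneckerOn K₂ x₂ z =
        kroneckerOn (K₁.erase e ∪ K₂.erase e ∪ {e}) (K₁.piecewise x₁ x₂) z := by
      intro z
      have hmem : ∀ i, i ∈ K₁.erase e ∪ K₂.erase e ∪ {e} ↔ i ∈ K₁ ∨ i ∈ K₂ := by
        intro i
        by_cases hi : i = e
        · simp [hi, heK.1]
        · simp [hi]
      have hp : ∀ i ∈ K₂, K₁.piecewise x₁ x₂ i = x₂ i := by
        intro i hi
        by_cases h : i ∈ K₁
        · rw [hK' i h hi, Finset.piecewise_eq_of_mem _ _ _ heK.1, he]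
        · rw [Finset.piecewise_eq_of_notMem _ _ _ h]
      by_cases hz₁ : ∀ i ∈ K₁, x₁ i = z i
      · rw [kroneckerOn_of_eq hz₁, one_mul]
        by_cases hz₂ : ∀ i ∈ K₂, x₂ i = z i
        · rw [kroneckerOn_of_eq hz₂, kroneckerOn_of_eq]
          intro i hi
          rcases (hmem i).1 hi with h | h
          · rw [Finset.piecewise_eq_of_mem _ _ _ h, hz₁ i h]
          · rw [hp i h, hz₂ i h]
        · push Not at hz₂
          obtain ⟨i, hi, hne⟩ := hz₂
          rw [kroneckerOn_of_ne hi hne, kroneckerOn_of_ne ((hmem i).2 (Or.inr hi))]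
          rwa [hp i hi]
      · push Not at hz₁
        obtain ⟨i, hi, hne⟩ := hz₁
        rw [kroneckerOn_of_ne hi hne, zero_mul, kroneckerOn_of_ne ((hmem i).2 (Or.inl hi))]
        rwa [Finset.piecewise_eq_of_mem _ _ _ hi]
    simp only [h1]
    have h2 : DependsOn (marginalSum {e}
        (fun z => kroneckerOn (K₁.erase e ∪ K₂.erase e ∪ {e}) (K₁.piecewise x₁ x₂) z))
        ((K₁.erase e ∪ K₂.erase e : Finset ι) : Set ι) := by
      refine marginalSum_dependsOn ?_
      rw [← Finset.coe_union]
      exact kroneckerOn_dependsOn _ _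
    rw [marginalSum_base_irrel (y := K₁.piecewise x₁ x₂)]
    · simp only [← marginalSum_mul_left hc (by exact_mod_cast hde)]
      rw [← marginalSum_union hde, marginalSum_mul_kroneckerOn subset_rfl]
    · intro y z h
      simp only [hc h, h2 h]
  · rw [marginalSum_congr (g := fun _ => 0 * 0), marginalSum_const_mul, zero_mul]
    intro y _
    rw [marginalSum_congr (g := fun _ => 0 * 0), marginalSum_const_mul, zero_mul, mul_zero,
      mul_zero]
    intro z _
    by_cases hz : x₁ e = z e
    · rw [kroneckerOn_of_ne heK.2 (by rwa [← hz, ne_comm]), mul_zero, mul_zero]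
    · rw [kroneckerOn_of_ne heK.1 hz, zero_mul, mul_zero]

variable [∀ i, DecidableEq (Y i)] [∀ i, Nonempty (Y i)] {K₁ K₂ : Finset ι} {e : ι}
  {f₁ f₂ : (∀ i, X i) → S → ℂ} {g₁ g₂ : (∀ i, Y i) → S → ℂ}
  {W₁ W₂ W : (∀ i, Y i) → (∀ i, X i) → ℂ}

/-- The duals of `f₁` and `f₂` are applied to the two expressions for the contraction of `g₁` with
`g₂`, one through `W₁` and `W₂`, the other through `W`. -/
theorem sum_bond_mul_bond (hK : K₁ ∩ K₂ = {e})
    (hdf₁ : ∀ s, DependsOn (fun x => f₁ x s) (K₁ : Set ι))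
    (hdf₂ : ∀ s, DependsOn (fun x => f₂ x s) (K₂ : Set ι))
    (hf₁ : TensorInjective K₁ f₁) (hf₂ : TensorInjective K₂ f₂)
    (hW : ∀ y, DependsOn (W y) (K₁.erase e ∪ K₂.erase e : Finset ι))
    (hg₁ : ∀ s y x, g₁ y s = marginalSum K₁ (fun x => W₁ y x * f₁ x s) x)
    (hg₂ : ∀ s y x, g₂ y s = marginalSum K₂ (fun x => W₂ y x * f₂ x s) x)
    (hg : ∀ s t y x, marginalSum {e} (fun y => g₁ y s * g₂ y t) y =
      marginalSum (K₁.erase e ∪ K₂.erase e)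
        (fun x => W y x * marginalSum {e} (fun x => f₁ x s * f₂ x t) x) x)
    (y : ∀ i, Y i) (x₁ x₂ : ∀ i, X i) :
    ∑ k, W₁ (Function.update y e k) x₁ * W₂ (Function.update y e k) x₂ =
      if x₁ e = x₂ e then W y (K₁.piecewise x₁ x₂) else 0 := by
  obtain ⟨γ₁, -, hγ₁⟩ := hf₁.exists_dual hdf₁
  obtain ⟨γ₂, -, hγ₂⟩ := hf₂.exists_dual hdf₂
  rw [← marginalSum_mul_kroneckerOn_mul hK (hW y) x₁ x₂ x₁]
  have h1 : ∀ k, ∑ s, γ₁ x₁ s * g₁ (Function.update y e k) s = W₁ (Function.update y e k) x₁ := by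
    intro k
    simp only [hg₁ _ _ x₁]
    rw [sum_dual_mul_marginalSum hγ₁, marginalSum_mul_kroneckerOn subset_rfl]
  have h2 : ∀ k, ∑ s, γ₂ x₂ s * g₂ (Function.update y e k) s = W₂ (Function.update y e k) x₂ := by
    intro k
    simp only [hg₂ _ _ x₂]
    rw [sum_dual_mul_marginalSum hγ₂, marginalSum_mul_kroneckerOn subset_rfl]
  have h3 : ∀ s, ∑ t, γ₂ x₂ t * marginalSum {e} (fun y => g₁ y s * g₂ y t) y =
      ∑ k, W₂ (Function.update y e k) x₂ * g₁ (Function.update y e k) s := by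
    intro s
    simp only [← h2, marginalSum_singleton, Finset.mul_sum, Finset.sum_mul]
    rw [Finset.sum_comm]
    exact Finset.sum_congr rfl fun k _ => Finset.sum_congr rfl fun t _ => by ring
  have h4 : ∑ s, γ₁ x₁ s * ∑ t, γ₂ x₂ t * marginalSum {e} (fun y => g₁ y s * g₂ y t) y =
      ∑ k, W₁ (Function.update y e k) x₁ * W₂ (Function.update y e k) x₂ := by
    simp only [h3, ← h1, Finset.mul_sum, Finset.sum_mul]
    rw [Finset.sum_comm]
    exact Finset.sum_congr rfl fun k _ => Finset.sum_congr rfl fun t _ => by ring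
  rw [← h4]
  simp only [hg _ _ y x₁]
  simp only [sum_mul_marginalSum_marginalSum, hγ₂]
  simp only [mul_comm _ (kroneckerOn K₂ _ _), sum_mul_marginalSum_marginalSum, hγ₁]

/-- The matrix on the bond `e` obtained from `W` by fixing all other indices. -/
def bondSlice (W : (∀ i, Y i) → (∀ i, X i) → ℂ) (e : ι) (y : ∀ i, Y i) (x : ∀ i, X i) :
    Matrix (Y e) (X e) ℂ :=
  Matrix.of fun k l => W (Function.update y e k) (Function.update x e l)

theorem exists_bondSlice_transpose_mul (hK : K₁ ∩ K₂ = {e})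
    (hdf₁ : ∀ s, DependsOn (fun x => f₁ x s) (K₁ : Set ι))
    (hdf₂ : ∀ s, DependsOn (fun x => f₂ x s) (K₂ : Set ι))
    (hf₁ : TensorInjective K₁ f₁) (hf₂ : TensorInjective K₂ f₂)
    (hW : ∀ y, DependsOn (W y) (K₁.erase e ∪ K₂.erase e : Finset ι))
    (hW₁' : ∀ x, DependsOn (fun y => W₁ y x) (K₁ : Set ι))
    (hW₂' : ∀ x, DependsOn (fun y => W₂ y x) (K₂ : Set ι))
    (hg₁ : ∀ s y x, g₁ y s = marginalSum K₁ (fun x => W₁ y x * f₁ x s) x)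
    (hg₂ : ∀ s y x, g₂ y s = marginalSum K₂ (fun x => W₂ y x * f₂ x s) x)
    (hg : ∀ s t y x, marginalSum {e} (fun y => g₁ y s * g₂ y t) y =
      marginalSum (K₁.erase e ∪ K₂.erase e)
        (fun x => W y x * marginalSum {e} (fun x => f₁ x s * f₂ x t) x) x)
    (hne : ∃ y x, W y x ≠ 0) :
    ∃ N : Matrix (Y e) (X e) ℂ,
      (∀ y x, ∃ c : ℂ, (bondSlice W₁ e y x)ᵀ * N = c • (1 : Matrix (X e) (X e) ℂ)) ∧
      ∃ y x, ∃ c : ℂ, c ≠ 0 ∧ (bondSlice W₁ e y x)ᵀ * N = c • (1 : Matrix (X e) (X e) ℂ) := by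
  -- Apart from `e`, `W₁` sees only `K₁` and `W₂` only `K₂`. The arguments of the two slices can
  -- therefore be chosen independently and merged by `K₁.piecewise`.
  have key : ∀ y₁ y₂ x₁ x₂, (bondSlice W₁ e y₁ x₁)ᵀ * bondSlice W₂ e y₂ x₂ =
      W (K₁.piecewise y₁ y₂) (K₁.piecewise x₁ x₂) • (1 : Matrix (X e) (X e) ℂ) := by
    intro y₁ y₂ x₁ x₂
    ext i j
    have h := sum_bond_mul_bond hK hdf₁ hdf₂ hf₁ hf₂ hW hg₁ hg₂ hg
      (K₁.piecewise y₁ y₂) (Function.update x₁ e i) (Function.update x₂ e j)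
    have h1 : ∀ k x, W₁ (Function.update (K₁.piecewise y₁ y₂) e k) x =
        W₁ (Function.update y₁ e k) x := fun k x => hW₁' x fun i hi => by
      by_cases hie : i = e
      · subst hie; simp
      · simp [hie, Finset.mem_coe.1 hi]
    have h2 : ∀ k x, W₂ (Function.update (K₁.piecewise y₁ y₂) e k) x =
        W₂ (Function.update y₂ e k) x := fun k x => hW₂' x fun i hi => by
      by_cases hie : i = e
      · subst hie; simp
      · have : i ∉ K₁ := fun h => hie (by
          rw [← Finset.mem_singleton, ← hK]
          exact Finset.mem_inter.2 ⟨h, hi⟩)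
        simp [hie, this]
    have h3 : W (K₁.piecewise y₁ y₂)
        (K₁.piecewise (Function.update x₁ e i) (Function.update x₂ e j)) =
        W (K₁.piecewise y₁ y₂) (K₁.piecewise x₁ x₂) := hW _ fun l hl => by
      have hle : l ≠ e := by
        rintro rfl
        simp at hl
      by_cases hlK : l ∈ K₁ <;> simp [hlK, hle]
    simp only [h1, h2, h3, Function.update_self] at h
    simpa [Matrix.mul_apply, bondSlice, Matrix.one_apply] using h
  obtain ⟨y₀, x₀, h₀⟩ := hne
  -- One slice of `W₂` serves as `N` for all slices of `W₁`; it is taken where `W` does not vanish.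
  refine ⟨bondSlice W₂ e y₀ x₀, fun y x => ⟨_, key y y₀ x x₀⟩, y₀, x₀, _, ?_, key y₀ y₀ x₀ x₀⟩
  simpa only [Finset.piecewise_same] using h₀

end BondFactorization

/-! ### Bond matrices of regions and equality of bond dimensions -/

section EdgeGauge

variable {ι V : Type*} [Fintype ι] [DecidableEq ι] [Fintype V] [DecidableEq V]
  {X Y : ι → Type*} [∀ i, Fintype (X i)] [∀ i, Fintype (Y i)]
  [∀ i, Nonempty (X i)] [∀ i, Nonempty (Y i)] {T : V → Type*} [∀ v, Fintype (T v)]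
  {E : EdgeEnds ι V} {a : ∀ v, (∀ i, X i) → T v → ℂ} {b : ∀ v, (∀ i, Y i) → T v → ℂ}
  {R S : Finset V} {e : ι}

theorem EdgeEnds.boundary_inter_boundary (h : Disjoint R S) :
    E.boundary R ∩ E.boundary S = E.between R S := by
  ext e
  have h1 : E.tail e ∈ R → E.tail e ∉ S := fun h' => Finset.disjoint_left.1 h h'
  have h2 : E.head e ∈ R → E.head e ∉ S := fun h' => Finset.disjoint_left.1 h h'
  simp only [EdgeEnds.mem_between, EdgeEnds.mem_boundary, Finset.mem_inter]
  tauto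

/-- Both networks are read as bipartite states across the cut between `R` and its complement. -/
theorem exists_region_bond_matrix (ha : IsLocalNetwork E a) (hb : IsLocalNetwork E b)
    (hstate : ∀ x y s, blockTensor E a Finset.univ x s = blockTensor E b Finset.univ y s)
    (haR : InjectiveRegion E a R) (hbR : InjectiveRegion E b Rᶜ) :
    ∃ W : (∀ i, Y i) → (∀ i, X i) → ℂ,
      (∀ y, DependsOn (W y) (E.boundary R : Set ι)) ∧
      (∀ x, DependsOn (fun y => W y x) (E.boundary R : Set ι)) ∧
      (∀ s y x, blockTensor E b R y s =
        marginalSum (E.boundary R) (fun x => W y x * blockTensor E a R x s) x) ∧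
      ∀ t x y, blockTensor E a Rᶜ x t =
        marginalSum (E.boundary R) (fun y => W y x * blockTensor E b Rᶜ y t) y := by
  have hda := ha.blockTensor_dependsOn Rᶜ
  have hdb := hb.blockTensor_dependsOn Rᶜ
  unfold InjectiveRegion at hbR
  rw [EdgeEnds.boundary_compl] at hda hdb hbR
  refine exists_bond_matrix hda hdb haR hbR fun s t x y => ?_
  rw [marginalSum_blockTensor_mul_compl ha, marginalSum_blockTensor_mul_compl hb, hstate]

variable [∀ i, DecidableEq (X i)] [∀ i, DecidableEq (Y i)]

/-- The bond matrix of the region `R` factorizes over the edge `e`, if `e` is the only edge between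
`R` and `S` in a tripartition into injective regions. -/
theorem exists_region_bond_matrix_factorization (ha : IsLocalNetwork E a)
    (hb : IsLocalNetwork E b)
    (hstate : ∀ x y s, blockTensor E a Finset.univ x s = blockTensor E b Finset.univ y s)
    (h : Disjoint R S) (he : E.between R S = {e})
    (haR : InjectiveRegion E a R) (haS : InjectiveRegion E a S)
    (hbR : InjectiveRegion E b R) (hbS : InjectiveRegion E b S)
    (hbRS : InjectiveRegion E b (R ∪ S)ᶜ) :
    ∃ W : (∀ i, Y i) → (∀ i, X i) → ℂ,
      (∀ s y x, blockTensor E b R y s =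
        marginalSum (E.boundary R) (fun x => W y x * blockTensor E a R x s) x) ∧
      (∀ t x y, blockTensor E a Rᶜ x t =
        marginalSum (E.boundary R) (fun y => W y x * blockTensor E b Rᶜ y t) y) ∧
      ∃ N : Matrix (Y e) (X e) ℂ,
        (∀ y x, ∃ c : ℂ, (bondSlice W e y x)ᵀ * N = c • (1 : Matrix (X e) (X e) ℂ)) ∧
        ∃ y x, ∃ c : ℂ, c ≠ 0 ∧
          (bondSlice W e y x)ᵀ * N = c • (1 : Matrix (X e) (X e) ℂ) := by
  have hRc : Rᶜ = S ∪ (R ∪ S)ᶜ := by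
    ext v
    have := fun hv : v ∈ R => Finset.disjoint_left.1 h hv
    simp only [Finset.mem_compl, Finset.mem_union]
    tauto
  have hSc : Sᶜ = R ∪ (R ∪ S)ᶜ := by
    ext v
    have := fun hv : v ∈ R => Finset.disjoint_left.1 h hv
    simp only [Finset.mem_compl, Finset.mem_union]
    tauto
  -- The complement of one part is the union of the other two, so it inherits injectivity.
  have hbRc : InjectiveRegion E b Rᶜ := by
    rw [hRc]
    exact hbS.union hb (disjoint_compl_right.mono_left Finset.subset_union_right) hbRS
  have hbSc : InjectiveRegion E b Sᶜ := by
    rw [hSc]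
    exact hbR.union hb (disjoint_compl_right.mono_left Finset.subset_union_left) hbRS
  obtain ⟨W₁, -, hW₁, hg₁, hf₁⟩ := exists_region_bond_matrix ha hb hstate haR hbRc
  obtain ⟨W₂, -, hW₂, hg₂, -⟩ := exists_region_bond_matrix ha hb hstate haS hbSc
  obtain ⟨W, hW, -, hg, -⟩ := exists_region_bond_matrix ha hb hstate (haR.union ha h haS) hbRS
  have hK : E.boundary R ∩ E.boundary S = {e} := by
    rw [EdgeEnds.boundary_inter_boundary h, he]
  have hbd : E.boundary (R ∪ S) = (E.boundary R).erase e ∪ (E.boundary S).erase e := by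
    rw [EdgeEnds.boundary_union h, he, Finset.sdiff_singleton_eq_erase,
      Finset.sdiff_singleton_eq_erase]
  rw [hbd] at hW hg
  refine ⟨W₁, hg₁, hf₁, exists_bondSlice_transpose_mul hK (ha.blockTensor_dependsOn R)
    (ha.blockTensor_dependsOn S) haR haS hW hW₁ hW₂ hg₁ hg₂ (W := W) (fun s t y x => ?_) ?_⟩
  · have h1 := marginalSum_blockTensor_mul ha h
    have h2 := marginalSum_blockTensor_mul hb h
    rw [he] at h1 h2
    rw [h2, hg _ y x]
    simp only [h1]
  -- If `W` vanished, so would the blocked tensor of `b` on `R ∪ S`, which is injective.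
  · obtain ⟨y, s, hy⟩ := (hbR.union hb h hbS).exists_ne_zero
    by_contra! hW0
    obtain ⟨x⟩ : Nonempty (∀ i, X i) := inferInstance
    rw [hg s y x, marginalSum_congr (g := fun _ => 0 * 0), marginalSum_const_mul, zero_mul] at hy
    · exact hy rfl
    · intro x' _
      rw [hW0, zero_mul, mul_zero]

/-- A slice with nonzero scalar gives `N` a left inverse, so `N` embeds the bond space of `a` into
that of `b`. -/
theorem card_bond_le (ha : IsLocalNetwork E a) (hb : IsLocalNetwork E b)
    (hstate : ∀ x y s, blockTensor E a Finset.univ x s = blockTensor E b Finset.univ y s)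
    (h : Disjoint R S) (he : E.between R S = {e})
    (haR : InjectiveRegion E a R) (haS : InjectiveRegion E a S)
    (hbR : InjectiveRegion E b R) (hbS : InjectiveRegion E b S)
    (hbRS : InjectiveRegion E b (R ∪ S)ᶜ) : Fintype.card (X e) ≤ Fintype.card (Y e) := by
  obtain ⟨W, -, -, N, -, y, x, c, hc, hN⟩ :=
    exists_region_bond_matrix_factorization ha hb hstate h he haR haS hbR hbS hbRS
  have h1 : (c⁻¹ • (bondSlice W e y x)ᵀ) * N = 1 := by
    rw [Matrix.smul_mul, hN, smul_smul, inv_mul_cancel₀ hc, one_smul]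
  have hinj : Function.Injective N.mulVecLin := by
    intro u w huw
    have := congrArg (fun z => (c⁻¹ • (bondSlice W e y x)ᵀ) *ᵥ z) huw
    simpa [Matrix.mulVec_mulVec, h1] using this
  simpa using LinearMap.finrank_le_finrank_of_injective hinj

end EdgeGauge

/-! ### The gauge matrix of an edge -/

section EdgeGaugeSquare

variable {ι V : Type*} [Fintype ι] [DecidableEq ι] [Fintype V] [DecidableEq V]
  {X : ι → Type*} [∀ i, Fintype (X i)] [∀ i, Nonempty (X i)] [∀ i, DecidableEq (X i)]
  {T : V → Type*} [∀ v, Fintype (T v)]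
  {E : EdgeEnds ι V} {a b : ∀ v, (∀ i, X i) → T v → ℂ} {R S : Finset V} {e : ι}

/-- With equal bond dimensions `N` is invertible, so every slice of `W` along `e` is a multiple of
the single matrix `Zᵀ`. Hence `W` intertwines `M` on the side of `b` with its conjugate on the side
of `a`. -/
theorem exists_edge_gauge (ha : IsLocalNetwork E a) (hb : IsLocalNetwork E b)
    (hstate : ∀ x y s, blockTensor E a Finset.univ x s = blockTensor E b Finset.univ y s)
    (h : Disjoint R S) (he : E.between R S = {e}) (ht : E.tail e ∈ R)
    (haR : InjectiveRegion E a R) (haS : InjectiveRegion E a S)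
    (hbR : InjectiveRegion E b R) (hbS : InjectiveRegion E b S)
    (hbRS : InjectiveRegion E b (R ∪ S)ᶜ) :
    ∃ Z : GL (X e) ℂ, ∀ M M' : ∀ i, Matrix (X i) (X i) ℂ,
      M' e = (Z⁻¹).valᵀ * M e * Z.valᵀ → ∀ x s,
        blockTensor E (insertMatrix E a e M') Finset.univ x s =
          blockTensor E (insertMatrix E b e M) Finset.univ x s := by
  obtain ⟨W, hg, hf, N, hN, y₀, x₀, c₀, hc₀, hN₀⟩ :=
    exists_region_bond_matrix_factorization ha hb hstate h he haR haS hbR hbS hbRS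
  have h1 : (c₀⁻¹ • (bondSlice W e y₀ x₀)ᵀ) * N = 1 := by
    rw [Matrix.smul_mul, hN₀, smul_smul, inv_mul_cancel₀ hc₀, one_smul]
  let Z : GL (X e) ℂ := ⟨c₀⁻¹ • (bondSlice W e y₀ x₀)ᵀ, N, h1, _root_.mul_eq_one_comm.1 h1⟩
  have hslice : ∀ y x, ∃ c : ℂ, bondSlice W e y x = c • Z.valᵀ := by
    intro y x
    obtain ⟨c, hc⟩ := hN y x
    refine ⟨c, ?_⟩
    rw [← Matrix.transpose_inj, Matrix.transpose_smul, Matrix.transpose_transpose]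
    have h2 : N * Z.val = 1 := Z.inv_mul
    rw [← Matrix.mul_one (bondSlice W e y x)ᵀ, ← h2, ← Matrix.mul_assoc, hc, Matrix.smul_mul,
      Matrix.one_mul]
  have heb : e ∈ E.boundary R := EdgeEnds.between_subset_boundary h (by simp [he])
  refine ⟨Z, fun M M' hM x s => ?_⟩
  have e1 := blockTensor_insertMatrix_univ ha heb M' x s s
  have e2 := blockTensor_insertMatrix_univ hb heb M x s s
  simp only [Finset.piecewise_same, if_pos ht] at e1 e2
  rw [e1, e2, marginalSum_matrixAct_bond_left (f₁ := blockTensor E a R)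
    (g₂ := blockTensor E b Rᶜ) hg M s s x x, marginalSum_matrixAct_bond_right
    (g₂ := blockTensor E b Rᶜ) (f₂ := blockTensor E a Rᶜ) hf heb M' s s x x]
  refine marginalSum_congr fun y' _ => ?_
  congr 1
  refine marginalSum_congr fun x' _ => ?_
  congr 1
  obtain ⟨c, hc⟩ := hslice y' x'
  have hW1 : ∀ k, W (Function.update y' e k) x' = c * Z.valᵀ k (x' e) := by
    intro k
    have := congrFun (congrFun hc k) (x' e)
    simpa [bondSlice] using this
  have hW2 : ∀ k, W y' (Function.update x' e k) = c * Z.valᵀ (y' e) k := by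
    intro k
    have := congrFun (congrFun hc (y' e)) k
    simpa [bondSlice] using this
  -- The intertwining relation; the scalar `c` depends only on the fixed slice and factors out of
  -- both sums.
  have hMZ : M e * Z.valᵀ = Z.valᵀ * M' e := by
    rw [hM, ← Matrix.mul_assoc, ← Matrix.mul_assoc, ← Matrix.transpose_mul, ← Units.val_mul,
      inv_mul_cancel, Units.val_one, Matrix.transpose_one, Matrix.one_mul]
  have hent := congrFun (congrFun hMZ (y' e)) (x' e)
  rw [Matrix.mul_apply, Matrix.mul_apply] at hent
  rw [matrixAct_singleton, matrixAct_singleton]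
  simp only [hW1, hW2, Matrix.transpose_apply (M' e)]
  calc _ = c * ∑ k, Z.valᵀ (y' e) k * M' e k (x' e) := by
        rw [Finset.mul_sum]
        exact Finset.sum_congr rfl fun k _ => by ring
    _ = c * ∑ k, M e (y' e) k * Z.valᵀ k (x' e) := by rw [hent]
    _ = _ := by
        rw [Finset.mul_sum]
        exact Finset.sum_congr rfl fun k _ => by ring

end EdgeGaugeSquare

/-! ### Proportional regions and proportional sites -/

section Proportional

variable {ι V : Type*} [Fintype ι] [DecidableEq ι] [Fintype V] [DecidableEq V]
  {X : ι → Type*} [∀ i, Fintype (X i)] [∀ i, Nonempty (X i)] [∀ i, DecidableEq (X i)]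
  {T : V → Type*} [∀ v, Fintype (T v)]
  {E : EdgeEnds ι V} {a b : ∀ v, (∀ i, X i) → T v → ℂ} {R S : Finset V} {e : ι}

theorem IsLocalNetwork.blockTensor_univ_base (ha : IsLocalNetwork E a) (x y : ∀ i, X i)
    (s : ∀ v, T v) : blockTensor E a Finset.univ x s = blockTensor E a Finset.univ y s := by
  have := ha.blockTensor_dependsOn Finset.univ s
  rw [EdgeEnds.boundary_univ, Finset.coe_empty] at this
  exact this.empty x y

theorem exists_blockTensor_proportional (ha : IsLocalNetwork E a) (hb : IsLocalNetwork E b)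
    (hstate : ∀ x s, blockTensor E a Finset.univ x s = blockTensor E b Finset.univ x s)
    (hins : ∀ e M x s, blockTensor E (insertMatrix E a e M) Finset.univ x s =
      blockTensor E (insertMatrix E b e M) Finset.univ x s)
    (haR : InjectiveRegion E a R) (hbR : InjectiveRegion E b R)
    (hbR' : InjectiveRegion E b Rᶜ) :
    ∃ c : ℂ, c ≠ 0 ∧ ∀ x s, blockTensor E b R x s = c * blockTensor E a R x s := by
  have hda := ha.blockTensor_dependsOn Rᶜ
  have hdb := hb.blockTensor_dependsOn Rᶜ
  unfold InjectiveRegion at hbR'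
  rw [EdgeEnds.boundary_compl] at hda hdb hbR'
  refine exists_proportional_of_insertions hda hdb haR hbR hbR' (fun s t x y => ?_)
    fun e he M s t x y => ?_
  · rw [marginalSum_blockTensor_mul_compl ha, marginalSum_blockTensor_mul_compl hb, hstate,
      hb.blockTensor_univ_base]
  -- An insertion of `N` acts on the `R` side as `N` or `Nᵀ`, according to the orientation; either
  -- way every `M` is attained.
  · have key : ∀ N : ∀ i, Matrix (X i) (X i) ℂ,
        M = (if E.tail e ∈ R then N else fun i => (N i)ᵀ) →
        marginalSum (E.boundary R) (fun y => matrixAct {e} M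
          (fun y => blockTensor E a R y s) y * blockTensor E a Rᶜ y t) x =
        marginalSum (E.boundary R) (fun y => matrixAct {e} M
          (fun y => blockTensor E b R y s) y * blockTensor E b Rᶜ y t) y := by
      rintro N rfl
      rw [← blockTensor_insertMatrix_univ ha he, ← blockTensor_insertMatrix_univ hb he, hins,
        (hb.insertMatrix e N).blockTensor_univ_base]
    by_cases ht : E.tail e ∈ R
    · exact key M (by rw [if_pos ht])
    · exact key (fun i => (M i)ᵀ) (by simp [if_neg ht])

/-- Splitting `insert v R` into `R` and `v` gives `c · a_R b_v = c' · a_R a_v`. The injective `a_R`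
cancels although only its edges to `v` are contracted. -/
theorem vertex_proportional (ha : IsLocalNetwork E a) (hb : IsLocalNetwork E b)
    {v : V} (hv : v ∉ R) {c c' : ℂ} (hc : c ≠ 0)
    (hR : ∀ x s, blockTensor E b R x s = c * blockTensor E a R x s)
    (hS : ∀ x s, blockTensor E b (insert v R) x s = c' * blockTensor E a (insert v R) x s)
    (haR : InjectiveRegion E a R) (x : ∀ i, X i) (σ : T v) :
    b v x σ = c' / c * a v x σ := by
  have hd : Disjoint R {v} := by simpa using hv
  have h0 : c' * a v x σ - c * b v x σ = 0 := by
    refine haR.cancel_of_subset (ha.blockTensor_dependsOn R)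
      (EdgeEnds.between_subset_boundary hd) (c := fun x => c' * a v x σ - c * b v x σ) fun s => ?_
    have h1 := hS x (R.piecewise s (Function.update s v σ))
    rw [Finset.insert_eq, Finset.union_comm, ← marginalSum_blockTensor_mul ha hd,
      ← marginalSum_blockTensor_mul hb hd] at h1
    simp only [blockTensor_singleton, Function.update_self, hR] at h1
    simp only [sub_mul]
    rw [marginalSum_sub, sub_eq_zero]
    simp only [mul_assoc, marginalSum_const_mul] at h1 ⊢
    simp only [mul_comm (a v _ σ), mul_comm (b v _ σ)]
    rw [h1]
  rw [div_mul_eq_mul_div, eq_div_iff hc, mul_comm, ← sub_eq_zero.1 h0]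

theorem blockTensor_of_proportional {c : V → ℂ} (h : ∀ v x σ, b v x σ = c v * a v x σ)
    (x : ∀ i, X i) (s : ∀ v, T v) :
    blockTensor E b R x s = (∏ v ∈ R, c v) * blockTensor E a R x s := by
  unfold blockTensor
  simp only [h, Finset.prod_mul_distrib]
  rw [marginalSum_const_mul]

end Proportional

/-! ### Vertex scalars as boundaries of edge scalars -/

section Scalars

variable {ι V : Type*} [Fintype ι] [DecidableEq ι] [Fintype V] [DecidableEq V]
  {E : EdgeEnds ι V} {C : Type*} [CommGroup C]

/-- The boundary map from edge scalars to vertex scalars. -/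
noncomputable def EdgeEnds.boundaryHom (E : EdgeEnds ι V) (C : Type*) [CommGroup C] :
    (ι → C) →* (V → C) where
  toFun z := ∏ i, (Pi.mulSingle (E.tail i) (z i) * (Pi.mulSingle (E.head i) (z i))⁻¹)
  map_one' := by simp
  map_mul' z w := by
    simp only [Pi.mul_apply, Pi.mulSingle_mul, mul_inv, Finset.prod_mul_distrib]
    exact mul_mul_mul_comm _ _ _ _

theorem EdgeEnds.boundaryHom_apply (z : ι → C) (v : V) :
    E.boundaryHom C z v = ∏ i ∈ E.boundary {v}, if E.tail i = v then z i else (z i)⁻¹ := by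
  have h1 : E.boundaryHom C z v = ∏ i, ((Pi.mulSingle (E.tail i) (z i) : V → C) v *
      ((Pi.mulSingle (E.head i) (z i) : V → C) v)⁻¹) := by
    simp [boundaryHom, Finset.prod_apply]
  rw [h1, ← Finset.prod_subset (Finset.subset_univ (E.boundary {v}))]
  · refine Finset.prod_congr rfl fun i hi => ?_
    rcases EdgeEnds.mem_boundary.1 hi with ⟨ht, hh⟩ | ⟨ht, hh⟩ <;>
      rw [Finset.mem_singleton] at ht hh
    · rw [if_pos ht, ht, Pi.mulSingle_eq_same, Pi.mulSingle_eq_of_ne (Ne.symm hh), inv_one,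
        mul_one]
    · rw [if_neg ht, hh, Pi.mulSingle_eq_same, Pi.mulSingle_eq_of_ne (Ne.symm ht), one_mul]
  · intro i _ hi
    have := E.tail_ne_head i
    simp only [EdgeEnds.mem_boundary, Finset.mem_singleton] at hi
    by_cases ht : E.tail i = v
    · exact absurd (Or.inl ⟨ht, fun hh => this (ht.trans hh.symm)⟩) hi
    · have hh : E.head i ≠ v := fun hh => hi (Or.inr ⟨ht, hh⟩)
      rw [Pi.mulSingle_eq_of_ne (Ne.symm ht), Pi.mulSingle_eq_of_ne (Ne.symm hh), inv_one,
        mul_one]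

/-- On a connected graph, vertex scalars with product one come from edge scalars. -/
theorem EdgeEnds.exists_boundaryHom_eq
    (hE : ∀ u w, Relation.EqvGen (fun u w => ∃ e, E.tail e = u ∧ E.head e = w) u w)
    (c : V → C) (hc : ∏ v, c v = 1) : ∃ z, E.boundaryHom C z = c := by
  rw [← MonoidHom.mem_range]
  -- A scalar `k` at `u` paired with `k⁻¹` at `w` is a boundary when an edge joins them; since the
  -- range is a subgroup, this passes along walks.
  have key : ∀ u w, ∀ k : C, Pi.mulSingle u k * (Pi.mulSingle w k)⁻¹ ∈ (E.boundaryHom C).range := by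
    intro u w k
    induction hE u w with
    | rel u w h =>
      obtain ⟨e, rfl, rfl⟩ := h
      refine ⟨Pi.mulSingle e k, ?_⟩
      change ∏ i, _ = _
      rw [Finset.prod_eq_single e]
      · rw [Pi.mulSingle_eq_same]
      · intro i _ hi
        rw [Pi.mulSingle_eq_of_ne hi, Pi.mulSingle_one, Pi.mulSingle_one, inv_one, mul_one]
      · simp
    | refl u => simp
    | symm u w _ ih =>
      have := inv_mem ih
      rwa [mul_inv, inv_inv, mul_comm] at this
    | trans u v w _ _ ih₁ ih₂ =>
      have := mul_mem ih₁ ih₂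
      rwa [mul_assoc, inv_mul_cancel_left] at this
  rcases isEmpty_or_nonempty V with hV | ⟨⟨r⟩⟩
  · rw [show c = 1 from Subsingleton.elim _ _]
    exact one_mem _
  -- Each scalar is compensated at a common root `r`; the compensations multiply to `(∏ v, c v)⁻¹ =
  -- 1`.
  · have : c = ∏ v, (Pi.mulSingle v (c v) * (Pi.mulSingle r (c v))⁻¹) := by
      rw [Finset.prod_mul_distrib, Finset.prod_inv_distrib]
      have h1 : ∏ v, Pi.mulSingle v (c v) = c := Finset.univ_prod_mulSingle c
      have h2 : ∏ v, (Pi.mulSingle r (c v) : V → C) = 1 :=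
        (map_prod (MonoidHom.mulSingle (fun _ : V => C) r) c _).symm.trans (by rw [hc, map_one])
      rw [h1, h2, inv_one, mul_one]
    rw [this]
    exact prod_mem fun v _ => key v r (c v)

end Scalars

/-! ### Absorbing scalars and uniqueness of the gauge -/

section GaugeFreedom

variable {ι V : Type*} [Fintype ι] [DecidableEq ι] [Fintype V] [DecidableEq V]
  {X : ι → Type*} [∀ i, Fintype (X i)] [∀ i, Nonempty (X i)] [∀ i, DecidableEq (X i)]
  {T : V → Type*} [∀ v, Fintype (T v)]
  {E : EdgeEnds ι V} {a b : ∀ v, (∀ i, X i) → T v → ℂ} {R S : Finset V} {e : ι}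

/-- The gauge `Z` with every matrix multiplied by a scalar. -/
noncomputable def scaleGauge (z : ι → ℂˣ) (Z : ∀ i, GL (X i) ℂ) (i : ι) : GL (X i) ℂ where
  val := (z i).val • (Z i).val
  inv := ((z i)⁻¹).val • ((Z i)⁻¹).val
  val_inv := by
    rw [Matrix.smul_mul, Matrix.mul_smul, smul_smul, ← Units.val_mul, ← Units.val_mul,
      mul_inv_cancel, mul_inv_cancel, Units.val_one, Units.val_one, one_smul]
  inv_val := by
    rw [Matrix.smul_mul, Matrix.mul_smul, smul_smul, ← Units.val_mul, ← Units.val_mul,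
      inv_mul_cancel, inv_mul_cancel, Units.val_one, Units.val_one, one_smul]

theorem gaugeNetwork_scaleGauge (z : ι → ℂˣ) (Z : ∀ i, GL (X i) ℂ) (v : V) (x : ∀ i, X i)
    (s : T v) :
    gaugeNetwork E (scaleGauge z Z) a v x s =
      (E.boundaryHom ℂˣ z v).val * gaugeNetwork E Z a v x s := by
  have h : ∀ i, gaugeMatrix E (scaleGauge z Z) {v} i =
      (if E.tail i = v then z i else (z i)⁻¹).val • gaugeMatrix E Z {v} i := by
    intro i
    unfold gaugeMatrix
    by_cases hi : E.tail i = v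
    · rw [if_pos (by simp [hi]), if_pos hi, if_pos (by simp [hi])]
      exact Matrix.transpose_smul _ _
    · rw [if_neg (by simp [hi]), if_neg hi, if_neg (by simp [hi])]
      rfl
  unfold gaugeNetwork matrixAct
  rw [← marginalSum_const_mul, EdgeEnds.boundaryHom_apply]
  refine marginalSum_congr fun y _ => ?_
  simp only [h, Matrix.smul_apply, smul_eq_mul, Finset.prod_mul_distrib, Units.coe_prod]
  ring

/-- Rescaling the gauge by edge scalars multiplies the site tensors by their boundary
(`gaugeNetwork_scaleGauge`), so suitable edge scalars reproduce `c`. -/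
theorem exists_gauge_of_proportional
    (hE : ∀ u w, Relation.EqvGen (fun u w => ∃ e, E.tail e = u ∧ E.head e = w) u w)
    {Z : ∀ i, GL (X i) ℂ} {c : V → ℂ}
    (hc : ∏ v, c v = 1) (h : ∀ v x s, b v x s = c v * gaugeNetwork E Z a v x s) :
    ∃ Z' : ∀ i, GL (X i) ℂ, ∀ v x s, b v x s = gaugeNetwork E Z' a v x s := by
  have hc0 : ∀ v, c v ≠ 0 := fun v =>
    Finset.prod_ne_zero_iff.1 (by rw [hc]; exact one_ne_zero) v (Finset.mem_univ v)
  obtain ⟨z, hz⟩ := E.exists_boundaryHom_eq hE (fun v => Units.mk0 (c v) (hc0 v))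
    (Units.ext (by simp [hc]))
  refine ⟨scaleGauge z Z, fun v x s => ?_⟩
  rw [gaugeNetwork_scaleGauge, hz, Units.val_mk0, h]

theorem gauge_unique (ha : IsLocalNetwork E a) {Z Z' : ∀ i, GL (X i) ℂ}
    (h : ∀ v x s, gaugeNetwork E Z a v x s = gaugeNetwork E Z' a v x s)
    (hR : InjectiveRegion E a R) (ht : E.tail e ∈ R) (hh : E.head e ∉ R) :
    ∃ c : ℂ, c ≠ 0 ∧ (Z' e).val = c • (Z e).val := by
  have heb : e ∈ E.boundary R := EdgeEnds.mem_boundary.2 (Or.inl ⟨ht, hh⟩)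
  -- Injectivity of `a` on `R` upgrades equality of the transformed block tensors to equality of the
  -- tensor products of the gauge matrices.
  have hprod : ∀ x y : ∀ i, X i, ∏ i ∈ E.boundary R, gaugeMatrix E Z R i (x i) (y i) =
      ∏ i ∈ E.boundary R, gaugeMatrix E Z' R i (x i) (y i) := by
    intro x y
    rw [← sub_eq_zero]
    refine hR (fun y => ∏ i ∈ E.boundary R, gaugeMatrix E Z R i (x i) (y i) -
      ∏ i ∈ E.boundary R, gaugeMatrix E Z' R i (x i) (y i)) y fun s => ?_
    rw [marginalSum_base_irrel (y := x)]
    · simp only [sub_mul]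
      rw [marginalSum_sub, sub_eq_zero]
      have h1 := congrFun (blockTensor_gaugeNetwork ha Z R s) x
      have h2 := congrFun (blockTensor_gaugeNetwork ha Z' R s) x
      have h3 : gaugeNetwork E Z a = gaugeNetwork E Z' a := by
        funext v x s
        exact h v x s
      rw [h3] at h1
      exact h1.symm.trans h2
    · intro y z hyz
      have hF := ha.blockTensor_dependsOn R s hyz
      dsimp only at hF ⊢
      rw [hF]
      congr 2 <;> exact Finset.prod_congr rfl fun i hi => by rw [hyz i hi]
  -- Invertible matrices have nonzero entries. Freezing such entries on all boundary edges but `e`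
  -- leaves an identity between multiples of the two matrices on `e`.
  have hne : ∀ i, ∃ k l, gaugeMatrix E Z R i k l ≠ 0 := by
    intro i
    by_contra! h0
    have hzero : gaugeMatrix E Z R i = 0 := by
      ext k l
      exact h0 k l
    have hunit : IsUnit (gaugeMatrix E Z R i) := by
      unfold gaugeMatrix
      split_ifs
      · rw [Matrix.isUnit_transpose]
        exact (Z i).isUnit
      · exact (Z i)⁻¹.isUnit
    exact hunit.ne_zero hzero
  choose x₀ y₀ h₀ using hne
  set P := ∏ i ∈ (E.boundary R).erase e, gaugeMatrix E Z R i (x₀ i) (y₀ i)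
  set P' := ∏ i ∈ (E.boundary R).erase e, gaugeMatrix E Z' R i (x₀ i) (y₀ i)
  have hP : P ≠ 0 := Finset.prod_ne_zero_iff.2 fun i _ => h₀ i
  have hent : ∀ k l, gaugeMatrix E Z R e k l * P = gaugeMatrix E Z' R e k l * P' := by
    intro k l
    have := hprod (Function.update x₀ e k) (Function.update y₀ e l)
    rw [← Finset.mul_prod_erase _ _ heb, ← Finset.mul_prod_erase _ _ heb] at this
    simp only [Function.update_self] at this
    rw [Finset.prod_congr rfl fun i hi => by
        rw [Function.update_of_ne (Finset.ne_of_mem_erase hi),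
          Function.update_of_ne (Finset.ne_of_mem_erase hi)],
      Finset.prod_congr (f := fun i => gaugeMatrix E Z' R i _ _) rfl fun i hi => by
        rw [Function.update_of_ne (Finset.ne_of_mem_erase hi),
          Function.update_of_ne (Finset.ne_of_mem_erase hi)]] at this
    exact this
  have hP' : P' ≠ 0 := by
    intro h0
    have := hent (x₀ e) (y₀ e)
    rw [h0, mul_zero] at this
    exact mul_ne_zero (h₀ e) hP this
  refine ⟨P / P', div_ne_zero hP hP', ?_⟩
  ext k l
  have := hent l k
  simp only [gaugeMatrix, if_pos ht, Matrix.transpose_apply] at this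
  rw [Matrix.smul_apply, smul_eq_mul, div_mul_eq_mul_div, eq_div_iff hP', ← this, mul_comm]

end GaugeFreedom

/-! ### From PEPS on a simple graph to abstract networks -/

section Conversion

variable {V : Type*} [Fintype V] [DecidableEq V] {G : SimpleGraph V} [DecidableRel G.Adj]
  {d : V → ℕ} {D : G.edgeSet → ℕ}

/-- The endpoints of the edges of a graph that is oriented by `tail`. -/
noncomputable def SimpleGraph.edgeEnds (G : SimpleGraph V) (tail : G.edgeSet → V)
    (htail : ∀ e : G.edgeSet, tail e ∈ (e : Sym2 V)) : EdgeEnds G.edgeSet V where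
  tail := tail
  head e := Sym2.Mem.other (htail e)
  tail_ne_head e := (G.edge_other_ne e.2 (htail e)).symm

variable {tail : G.edgeSet → V} {htail : ∀ e : G.edgeSet, tail e ∈ (e : Sym2 V)}
  {R S R₁ R₂ R₃ : Finset V} {e : G.edgeSet} {v : V}

theorem SimpleGraph.mem_edge_iff (htail : ∀ e : G.edgeSet, tail e ∈ (e : Sym2 V)) :
    v ∈ (e : Sym2 V) ↔
      v = (G.edgeEnds tail htail).tail e ∨ v = (G.edgeEnds tail htail).head e := by
  have : (e : Sym2 V) = s((G.edgeEnds tail htail).tail e, (G.edgeEnds tail htail).head e) :=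
    (Sym2.other_spec (htail e)).symm
  rw [this, Sym2.mem_iff]

theorem SimpleGraph.boundaryEdge_iff :
    ((∃ v ∈ R, v ∈ (e : Sym2 V)) ∧ ∃ w, w ∉ R ∧ w ∈ (e : Sym2 V)) ↔
      e ∈ (G.edgeEnds tail htail).boundary R := by
  simp only [SimpleGraph.mem_edge_iff htail, EdgeEnds.mem_boundary, and_or_left, exists_or,
    exists_eq_right]
  tauto

theorem SimpleGraph.touchingEdge_iff :
    (∃ v ∈ R, v ∈ (e : Sym2 V)) ↔
      e ∈ (G.edgeEnds tail htail).boundary R ∪ (G.edgeEnds tail htail).interior R := by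
  simp only [SimpleGraph.mem_edge_iff htail, Finset.mem_union, EdgeEnds.mem_boundary,
    EdgeEnds.mem_interior, and_or_left, exists_or, exists_eq_right]
  tauto

theorem SimpleGraph.mem_boundary_singleton_iff :
    v ∈ (e : Sym2 V) ↔ e ∈ (G.edgeEnds tail htail).boundary {v} := by
  have := (G.edgeEnds tail htail).tail_ne_head e
  rw [SimpleGraph.mem_edge_iff htail]
  simp only [EdgeEnds.mem_boundary, Finset.mem_singleton]
  constructor
  · rintro (rfl | rfl)
    · exact Or.inl ⟨rfl, this.symm⟩
    · exact Or.inr ⟨this, rfl⟩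
  · rintro (⟨h, -⟩ | ⟨-, h⟩)
    · exact Or.inl h.symm
    · exact Or.inr h.symm

theorem SimpleGraph.Connected.eqvGen_edgeEnds (hG : G.Connected) (u w : V) :
    Relation.EqvGen (fun u w => ∃ e, (G.edgeEnds tail htail).tail e = u ∧
      (G.edgeEnds tail htail).head e = w) u w := by
  obtain ⟨p⟩ := hG.preconnected u w
  induction p with
  | nil => exact Relation.EqvGen.refl _
  | @cons u v w h _ ih =>
    refine Relation.EqvGen.trans _ _ _ ?_ ih
    let e : G.edgeSet := ⟨s(u, v), h⟩
    have hu := (SimpleGraph.mem_edge_iff (e := e) htail).1 (Sym2.mem_mk_left u v)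
    have hv := (SimpleGraph.mem_edge_iff (e := e) htail).1 (Sym2.mem_mk_right u v)
    have hne := h.ne
    rcases hu with hu | hu <;> rcases hv with hv | hv
    · exact absurd (hu.trans hv.symm) hne
    · exact Relation.EqvGen.rel _ _ ⟨e, hu.symm, hv.symm⟩
    · exact Relation.EqvGen.symm _ _ (Relation.EqvGen.rel _ _ ⟨e, hv.symm, hu.symm⟩)
    · exact absurd (hu.trans hv.symm) hne

namespace PEPS

/-- The tensors of a PEPS as functions of the virtual indices of all edges. -/
def network (A : PEPS G d D) (v : V) (x : ∀ e, Fin (D e)) (s : Fin (d v)) : ℂ :=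
  A.tensor v (fun e => x e.1) s

theorem network_isLocal (A : PEPS G d D) : IsLocalNetwork (G.edgeEnds tail htail) A.network := by
  intro v s x y h
  unfold network
  dsimp only
  congr 1
  funext e
  exact h e.1 (SimpleGraph.mem_boundary_singleton_iff.1 e.2)

theorem state_eq_blockTensor (A : PEPS G d D) (x : ∀ e, Fin (D e)) (s : ∀ v, Fin (d v)) :
    A.state s = blockTensor (G.edgeEnds tail htail) A.network Finset.univ x s := by
  have : (G.edgeEnds tail htail).interior Finset.univ = Finset.univ := by ext; simp
  rw [blockTensor, this, marginalSum_univ]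
  rfl

theorem blockTensor_network (A : PEPS G d D) (R : Finset V) (x : ∀ e, Fin (D e))
    (s : ∀ v, Fin (d v)) :
    blockTensor (G.edgeEnds tail htail) A.network R x s =
      A.blocked R (fun e => x e.1) (fun v => s v) := by
  set E := G.edgeEnds tail htail
  have hd : Disjoint (E.boundary R) (E.interior R) := by
    rw [Finset.disjoint_left]
    intro e
    simp only [EdgeEnds.mem_boundary, EdgeEnds.mem_interior]
    tauto
  -- The definition of `blocked` sums over the boundary indices too, under a constraint; the delta
  -- supplies that extra sum.
  have h1 : blockTensor E A.network R x s = marginalSum (E.boundary R ∪ E.interior R)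
      (fun y => kroneckerOn (E.boundary R) x y * ∏ v ∈ R, A.network v y (s v)) x := by
    rw [marginalSum_union hd, ← marginalSum_mul_kroneckerOn (subset_refl (E.boundary R))
      (fun x => blockTensor E A.network R x s) x]
    refine marginalSum_congr fun y _ => ?_
    rw [marginalSum_mul_left (kroneckerOn_dependsOn _ x) (by exact_mod_cast hd), mul_comm]
    rfl
  rw [h1, marginalSum_eq_sum_subtype _ (fun e : G.edgeSet => ∃ v ∈ R, v ∈ (e : Sym2 V))
    (fun e => SimpleGraph.touchingEdge_iff)]
  unfold blocked
  refine Finset.sum_congr rfl fun p _ => ?_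
  have hp : ∀ e : TouchingEdge G R,
      (if h : ∃ v ∈ R, v ∈ (e.1 : Sym2 V) then p ⟨e.1, h⟩ else x e.1) = p e :=
    fun e => dif_pos e.2
  split_ifs with h
  · rw [kroneckerOn_of_eq, one_mul, ← Finset.prod_coe_sort]
    · refine Finset.prod_congr rfl fun v _ => ?_
      unfold network
      congr 1
      funext e
      exact hp ⟨e.1, v.1, v.2, e.2⟩
    · intro e he
      have hb := SimpleGraph.boundaryEdge_iff.2 he
      rw [hp ⟨e, hb.1⟩]
      exact (h ⟨e, hb⟩).symm
  · push Not at h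
    obtain ⟨e, he⟩ := h
    rw [kroneckerOn_of_ne (SimpleGraph.boundaryEdge_iff.1 e.2), zero_mul]
    rw [hp ⟨e.1, e.2.1⟩]
    exact he.symm

/-- Network tensors take global physical configurations, so one given on `R` must be extended; this
needs positive physical dimensions. -/
theorem InjectiveOn.injectiveRegion {A : PEPS G d D} (hA : A.InjectiveOn R)
    (hd : ∀ v, 0 < d v) : InjectiveRegion (G.edgeEnds tail htail) A.network R := by
  classical
  set E := G.edgeEnds tail htail
  intro c x hc
  have h1 := hA (fun β => c fun e =>
    if h : (∃ v ∈ R, v ∈ (e : Sym2 V)) ∧ ∃ w, w ∉ R ∧ w ∈ (e : Sym2 V) then β ⟨e, h⟩ else x e)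
    fun s => by
      have h2 := hc fun v => if h : v ∈ R then s ⟨v, h⟩ else ⟨0, hd v⟩
      rw [marginalSum_eq_sum_subtype _
        (fun e : G.edgeSet => (∃ v ∈ R, v ∈ (e : Sym2 V)) ∧ ∃ w, w ∉ R ∧ w ∈ (e : Sym2 V))
        (fun e => SimpleGraph.boundaryEdge_iff)] at h2
      rw [← h2]
      refine Finset.sum_congr rfl fun β _ => ?_
      rw [blockTensor_network]
      congr 2
      · funext e
        rw [dif_pos e.2]
      · funext v
        rw [dif_pos v.2]
  have h3 := congrFun h1 fun e => x e.1
  simpa using h3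

/-- If `d v = 0`, the region has no physical configurations, so its blocked map would kill the
constant `1` on a nonempty virtual index set. -/
theorem InjectiveOn.phys_pos {A : PEPS G d D} (hA : A.InjectiveOn R) (hD : ∀ e, 0 < D e)
    (hv : v ∈ R) : 0 < d v := by
  by_contra h0
  have h0' : d v = 0 := by omega
  have h1 := hA (fun _ => 1) fun s => by
    have := (s ⟨v, hv⟩).isLt
    simp only at this
    omega
  exact one_ne_zero (congrFun h1 fun e => ⟨0, hD e.1⟩)

theorem isGauge_iff {A B : PEPS G d D} (hD : ∀ e, 0 < D e) (Z : ∀ e, GL (Fin (D e)) ℂ) :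
    IsGauge tail A B Z ↔ ∀ v x s, B.network v x s =
      gaugeNetwork (G.edgeEnds tail htail) Z A.network v x s := by
  classical
  have key : ∀ v x s, gaugeNetwork (G.edgeEnds tail htail) Z A.network v x s =
      ∑ α : (∀ e : {e : G.edgeSet // v ∈ (e : Sym2 V)}, Fin (D e.1)),
        A.tensor v α s * ∏ e : {e : G.edgeSet // v ∈ (e : Sym2 V)},
          if tail e.1 = v then (Z e.1).val (α e) (x e) else ((Z e.1)⁻¹).val (x e) (α e) := by
    intro v x s
    rw [gaugeNetwork, matrixAct, marginalSum_eq_sum_subtype _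
      (fun e : G.edgeSet => v ∈ (e : Sym2 V)) fun e => SimpleGraph.mem_boundary_singleton_iff]
    refine Finset.sum_congr rfl fun α _ => ?_
    have hα : ∀ e : {e : G.edgeSet // v ∈ (e : Sym2 V)},
        (if h : v ∈ (e.1 : Sym2 V) then α ⟨e.1, h⟩ else x e.1) = α e := fun e => dif_pos e.2
    rw [mul_comm]
    congr 1
    · unfold network
      congr 1
      funext e
      exact hα e
    · rw [Finset.prod_subtype _ fun e => SimpleGraph.mem_boundary_singleton_iff.symm]
      refine Finset.prod_congr rfl fun e _ => ?_
      refine (congrArg (gaugeMatrix _ Z {v} e.1 (x e.1)) (hα e)).trans ?_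
      unfold gaugeMatrix
      have : (G.edgeEnds tail htail).tail e.1 = tail e.1 := rfl
      simp only [this, Finset.mem_singleton]
      split_ifs <;> rfl
  constructor
  · intro h v x s
    rw [key, network, h]
  · intro h v β s
    -- Edges not incident to `v` receive the default index `0`, which exists since `D e > 0`.
    have := h v (fun e => if h : v ∈ (e : Sym2 V) then β ⟨e, h⟩ else ⟨0, hD e⟩) s
    rw [key] at this
    have hβ : (fun e : {e : G.edgeSet // v ∈ (e : Sym2 V)} =>
        if h : v ∈ (e.1 : Sym2 V) then β ⟨e.1, h⟩ else ⟨0, hD e.1⟩) = β :=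
      funext fun e => dif_pos e.2
    unfold network at this
    rw [hβ] at this
    rw [this]
    refine Finset.sum_congr rfl fun α _ => ?_
    congr 1
    refine Finset.prod_congr rfl fun e _ => ?_
    rw [congrFun hβ e]

theorem IsTripartitionAround.symm (h : IsTripartitionAround e R₁ R₂ R₃) :
    IsTripartitionAround e R₂ R₁ R₃ :=
  ⟨h.1.symm, h.2.2.1, h.2.1, by rw [Finset.union_comm R₂, h.2.2.2.1],
    fun f => by rw [and_comm, h.2.2.2.2 f]⟩

theorem IsTripartitionAround.compl_union (h : IsTripartitionAround e R₁ R₂ R₃) :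
    (R₁ ∪ R₂)ᶜ = R₃ := by
  rw [compl_eq_iff_isCompl]
  exact ⟨Finset.disjoint_union_left.2 ⟨h.2.1, h.2.2.1⟩, codisjoint_iff.2 h.2.2.2.1⟩

theorem IsTripartitionAround.between_eq (h : IsTripartitionAround e R₁ R₂ R₃) :
    (G.edgeEnds tail htail).between R₁ R₂ = {e} := by
  ext f
  rw [Finset.mem_singleton, ← h.2.2.2.2 f]
  have h1 : ∀ v, v ∈ R₁ → v ∉ R₂ := fun v h' => Finset.disjoint_left.1 h.1 h'
  have h2 := h1 ((G.edgeEnds tail htail).tail f)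
  have h3 := h1 ((G.edgeEnds tail htail).head f)
  simp only [SimpleGraph.mem_edge_iff htail, EdgeEnds.mem_between, and_or_left, exists_or,
    exists_eq_right]
  tauto

end PEPS

end Conversion

/-! ### Site scalars and the main theorem -/

section Main

variable {ι V : Type*} [Fintype ι] [DecidableEq ι] [Fintype V] [DecidableEq V]
  {X : ι → Type*} [∀ i, Fintype (X i)] [∀ i, Nonempty (X i)] [∀ i, DecidableEq (X i)]
  {T : V → Type*} [∀ v, Fintype (T v)]
  {E : EdgeEnds ι V} {a b : ∀ v, (∀ i, X i) → T v → ℂ}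

/-- Two networks that give the same state for all insertions of a matrix on an edge have
proportional tensors. -/
theorem exists_vertex_scalars [Nonempty V] (ha : IsLocalNetwork E a) (hb : IsLocalNetwork E b)
    (hstate : ∀ x s, blockTensor E a Finset.univ x s = blockTensor E b Finset.univ x s)
    (hins : ∀ e M x s, blockTensor E (insertMatrix E a e M) Finset.univ x s =
      blockTensor E (insertMatrix E b e M) Finset.univ x s)
    (hsite : ∀ v, ∃ R : Finset V, v ∉ R ∧ InjectiveRegion E a R ∧ InjectiveRegion E b R ∧
      InjectiveRegion E b Rᶜ ∧ InjectiveRegion E a (insert v R) ∧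
      InjectiveRegion E b (insert v R) ∧ InjectiveRegion E b (insert v R)ᶜ) :
    ∃ c : V → ℂ, ∏ v, c v = 1 ∧ ∀ v x s, b v x s = c v * a v x s := by
  have hv : ∀ v, ∃ c : ℂ, ∀ x s, b v x s = c * a v x s := by
    intro v
    obtain ⟨R, hvR, haR, hbR, hbR', haS, hbS, hbS'⟩ := hsite v
    obtain ⟨c, hc, hcR⟩ := exists_blockTensor_proportional ha hb hstate hins haR hbR hbR'
    obtain ⟨c', -, hcS⟩ := exists_blockTensor_proportional ha hb hstate hins haS hbS hbS'
    exact ⟨c' / c, vertex_proportional ha hb hvR hc hcR hcS haR⟩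
  choose c hc using hv
  refine ⟨c, ?_, hc⟩
  obtain ⟨v⟩ := ‹Nonempty V›
  obtain ⟨R, -, -, hbR, hbR', -⟩ := hsite v
  -- The whole graph is a union of two injective regions, so the state is nonzero and fixes the
  -- product of the scalars.
  obtain ⟨x, s, hx⟩ := (hbR.union hb disjoint_compl_right hbR').exists_ne_zero
  rw [Finset.union_compl] at hx
  have h1 := blockTensor_of_proportional (E := E) (R := Finset.univ) hc x s
  rw [hstate] at h1
  exact mul_right_cancel₀ hx (by rw [one_mul, ← h1])

end Main

theorem exists_insert_eq_of_symmDiff_eq_singleton {V : Type*} [DecidableEq V] {R S : Finset V}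
    {v : V} (h : symmDiff R S = {v}) : v ∉ S ∧ R = insert v S ∨ v ∉ R ∧ S = insert v R := by
  have h1 : ∀ u, (u ∈ R ∧ u ∉ S ∨ u ∈ S ∧ u ∉ R) ↔ u = v := fun u => by
    rw [← Finset.mem_symmDiff, h, Finset.mem_singleton]
  rcases (h1 v).2 rfl with ⟨hR, hS⟩ | ⟨hS, hR⟩
  · refine Or.inl ⟨hS, Finset.ext fun u => ?_⟩
    rw [Finset.mem_insert]
    by_cases hu : u = v
    · subst hu; tauto
    · have := h1 u
      tauto
  · refine Or.inr ⟨hR, Finset.ext fun u => ?_⟩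
    rw [Finset.mem_insert]
    by_cases hu : u = v
    · subst hu; tauto
    · have := h1 u
      tauto

theorem mainTheorem2 {V : Type*} [Fintype V] [DecidableEq V]
    (G : SimpleGraph V) [DecidableRel G.Adj] (hG : G.Connected)
    (d : V → ℕ) (D D' : G.edgeSet → ℕ) (hD : ∀ e, 0 < D e) (hD' : ∀ e, 0 < D' e)
    (A : PEPS G d D) (B : PEPS G d D')
    (hstate : A.state = B.state)
    (hedge : ∀ e : G.edgeSet, ∃ R₁ R₂ R₃ : Finset V,
      A.IsInjectiveMPSAround e R₁ R₂ R₃ ∧ B.IsInjectiveMPSAround e R₁ R₂ R₃)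
    (hsite : ∀ v : V, ∃ R S : Finset V, symmDiff R S = {v} ∧
      (A.InjectiveOn R ∧ A.InjectiveOn S ∧ A.InjectiveOn Rᶜ ∧ A.InjectiveOn Sᶜ) ∧
      (B.InjectiveOn R ∧ B.InjectiveOn S ∧ B.InjectiveOn Rᶜ ∧ B.InjectiveOn Sᶜ))
    (tail : G.edgeSet → V) (htail : ∀ e : G.edgeSet, tail e ∈ (e : Sym2 V)) :
    ∃ h : D = D',
      (∃ Z : ∀ e, GL (Fin (D' e)) ℂ, PEPS.IsGauge tail (h ▸ A) B Z) ∧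
      ∀ Z Z' : ∀ e, GL (Fin (D' e)) ℂ,
        PEPS.IsGauge tail (h ▸ A) B Z → PEPS.IsGauge tail (h ▸ A) B Z' →
        ∀ e, ∃ c : ℂ, c ≠ 0 ∧ (Z' e).val = c • (Z e).val := by
  set E := G.edgeEnds tail htail
  have hsite' : ∀ v : V, ∃ R : Finset V, v ∉ R ∧
      (A.InjectiveOn R ∧ A.InjectiveOn (insert v R)) ∧
      B.InjectiveOn R ∧ B.InjectiveOn Rᶜ ∧
      B.InjectiveOn (insert v R) ∧ B.InjectiveOn (insert v R)ᶜ := by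
    intro v
    obtain ⟨R, S, hRS, hA, hB⟩ := hsite v
    rcases exists_insert_eq_of_symmDiff_eq_singleton hRS with ⟨hv, rfl⟩ | ⟨hv, rfl⟩
    · exact ⟨S, hv, ⟨hA.2.1, hA.1⟩, hB.2.1, hB.2.2.2, hB.1, hB.2.2.1⟩
    · exact ⟨R, hv, ⟨hA.1, hA.2.1⟩, hB.1, hB.2.2.1, hB.2.1, hB.2.2.2⟩
  -- Every site lies in some injective region, namely the larger of its two.
  have hd : ∀ v, 0 < d v := fun v => by
    obtain ⟨R, -, hA, -⟩ := hsite' v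
    exact hA.2.phys_pos hD (Finset.mem_insert_self v R)
  have hedge' : ∀ e, ∃ R₁ R₂ : Finset V, Disjoint R₁ R₂ ∧ E.between R₁ R₂ = {e} ∧
      E.tail e ∈ R₁ ∧ E.head e ∉ R₁ ∧
      (InjectiveRegion E A.network R₁ ∧ InjectiveRegion E A.network R₂ ∧
        InjectiveRegion E A.network (R₁ ∪ R₂)ᶜ) ∧
      InjectiveRegion E B.network R₁ ∧ InjectiveRegion E B.network R₂ ∧
        InjectiveRegion E B.network (R₁ ∪ R₂)ᶜ := by
    intro e
    obtain ⟨R₁, R₂, R₃, hA, hB, ht, hh⟩ : ∃ R₁ R₂ R₃ : Finset V,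
        A.IsInjectiveMPSAround e R₁ R₂ R₃ ∧ B.IsInjectiveMPSAround e R₁ R₂ R₃ ∧
        E.tail e ∈ R₁ ∧ E.head e ∈ R₂ := by
      obtain ⟨R₁, R₂, R₃, hA, hB⟩ := hedge e
      have he : e ∈ E.between R₁ R₂ := by
        rw [hA.1.between_eq]
        exact Finset.mem_singleton_self e
      rcases EdgeEnds.mem_between.1 he with h | h
      · exact ⟨R₁, R₂, R₃, hA, hB, h⟩
      -- The first two parts are exchanged so that the given orientation of `e` leaves the first
      -- part.
      · exact ⟨R₂, R₁, R₃, ⟨hA.1.symm, hA.2.2.1, hA.2.1, hA.2.2.2⟩,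
          ⟨hB.1.symm, hB.2.2.1, hB.2.1, hB.2.2.2⟩, h⟩
    exact ⟨R₁, R₂, hA.1.1, hA.1.between_eq, ht, Finset.disjoint_right.1 hA.1.1 hh,
      ⟨hA.2.1.injectiveRegion hd, hA.2.2.1.injectiveRegion hd,
        hA.1.compl_union ▸ hA.2.2.2.injectiveRegion hd⟩,
      hB.2.1.injectiveRegion hd, hB.2.2.1.injectiveRegion hd,
        hA.1.compl_union ▸ hB.2.2.2.injectiveRegion hd⟩
  have hneA : ∀ e, Nonempty (Fin (D e)) := fun e => ⟨⟨0, hD e⟩⟩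
  have hneB : ∀ e, Nonempty (Fin (D' e)) := fun e => ⟨⟨0, hD' e⟩⟩
  have hlA : IsLocalNetwork E A.network := A.network_isLocal
  have hlB : IsLocalNetwork E B.network := B.network_isLocal
  have hst : ∀ x y s, blockTensor E A.network Finset.univ x s =
      blockTensor E B.network Finset.univ y s := fun x y s => by
    rw [← PEPS.state_eq_blockTensor, hstate, PEPS.state_eq_blockTensor]
  have hDD : D = D' := by
    funext e
    obtain ⟨R₁, R₂, h, he, -, -, hA, hB⟩ := hedge' e
    refine le_antisymm ?_ ?_
    · simpa using card_bond_le hlA hlB hst h he hA.1 hA.2.1 hB.1 hB.2.1 hB.2.2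
    · simpa using card_bond_le hlB hlA (fun x y s => (hst y x s).symm) h he hB.1 hB.2.1
        hA.1 hA.2.1 hA.2.2
  subst hDD
  refine ⟨rfl, ?_, fun Z Z' hZ hZ' e => ?_⟩
  · have hZ : ∀ e, ∃ Z : GL (Fin (D e)) ℂ, ∀ M M' : ∀ i, Matrix (Fin (D i)) (Fin (D i)) ℂ,
        M' e = (Z⁻¹).valᵀ * M e * Z.valᵀ → ∀ x s,
          blockTensor E (insertMatrix E A.network e M') Finset.univ x s =
            blockTensor E (insertMatrix E B.network e M) Finset.univ x s := by
      intro e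
      obtain ⟨R₁, R₂, h, he, ht, -, hA, hB⟩ := hedge' e
      exact exists_edge_gauge hlA hlB hst h he ht hA.1 hA.2.1 hB.1 hB.2.1 hB.2.2
    choose Z hZ using hZ
    have hne : Nonempty V := hG.nonempty
    -- The comparison is between `B` and the gauged `A`, for which the conjugations in `hZ` have
    -- been undone.
    obtain ⟨c, hc, hcB⟩ := exists_vertex_scalars (hlA.gaugeNetwork Z) hlB
      (fun x s => by rw [blockTensor_gaugeNetwork_univ hlA, hst x x])
      (fun e M x s => by
        rw [blockTensor_insertMatrix_gaugeNetwork hlA]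
        exact hZ e M _ rfl x s)
      (fun v => by
        obtain ⟨R, hv, hA, hB⟩ := hsite' v
        exact ⟨R, hv, (hA.1.injectiveRegion hd).gaugeNetwork hlA Z, hB.1.injectiveRegion hd,
          hB.2.1.injectiveRegion hd, (hA.2.injectiveRegion hd).gaugeNetwork hlA Z,
          hB.2.2.1.injectiveRegion hd, hB.2.2.2.injectiveRegion hd⟩)
    obtain ⟨Z', hZ'⟩ := exists_gauge_of_proportional hG.eqvGen_edgeEnds hc hcB
    exact ⟨Z', (PEPS.isGauge_iff hD Z').2 hZ'⟩
  · obtain ⟨R₁, R₂, -, -, ht, hh, hA, -⟩ := hedge' e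
    refine gauge_unique hlA (fun v x s => ?_) hA.1 ht hh
    rw [← (PEPS.isGauge_iff (htail := htail) hD Z).1 hZ v x s,
      ← (PEPS.isGauge_iff (htail := htail) hD Z').1 hZ' v x s]
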